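/- Conventions. Manifolds are finite-dimensional, smooth, Hausdorff and second countable, and Riemannian metrics are smooth. For a Riemannian metric $g$ on a manifold $X$, $d_g$ denotes its Riemannian distance and $\mu_g$ its Riemannian volume measure. For a set $X$ with a distance $d$ and a measure $\nu$, with closed balls $B(x,r)$, the volume doubling constant is $$D(X,d,\nu)=\sup_{x\in X,\ r>0}\frac{\nu(B(x,2r))}{\nu(B(x,r))}\in[0,\infty].$$ A set $\mathcal L'$ of Riemannian metrics on $X$ is *uniformly doubling* if there is a finite constant $C$ with $D(X,d_g,\mu_g)\le C$ for all $g\in\mathcal L'$. A Lie group $G$ is *uniformly doubling* if the set $\mathcal L(G)$ of all its left-invariant Riemannian metrics is uniformly doubling. A *Riemannian submersion* $(X,g)\to(Y,h)$ is a smooth map whose differential at each point is surjective and is isometric on the orthogonal complement of its kernel. **Theorem.** Let $G$ be a connected unimodular real Lie group with bi-invariant Haar measure $\mu$. (A) Let $G$ act smoothly and transitively from the right on a manifold $M$, let $p\in M$ and $\pi:G\to M$, $\pi(\sigma)=p\cdot\sigma$, and let $\nu$ be a $G$-invariant Radon measure on $M$. For a left-invariant Riemannian metric $g$ on $G$, write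 $h=\pi_*g$ for the Riemannian metric on $M$ for which $\pi:(G,g)\to(M,h)$ is a Riemannian submersion. 1. For every left-invariant Riemannian metric $g$ on $G$, with $h=\pi_*g$, $$D(M,d_h,\nu)\le D(G,d_g,\mu)^2 .$$ 2. If $G$ is uniformly doubling, then there is a finite constant $C$ such that $D(M,d_{\pi_*g},\nu)\le C$ for every left-invariant Riemannian metric $g$ on $G$. (B) Let $H$ be a quotient Lie group of $G$, that is, a Lie group with a surjective homomorphism $\varphi:G\to H$ that is a smooth submersion. 3. Let $\mathcal L'(G)\subset\mathcal L(G)$ and $\mathcal L'(H)\subset\mathcal L(H)$ be such that for every $h\in\mathcal L'(H)$ there is $g\in\mathcal L'(G)$ for which $\varphi:(G,g)\to(H,h)$ is a Riemannian submersion. If $\mathcal L'(G)$ is uniformly doubling, then so is $\mathcal L'(H)$. 4. If $G$ is uniformly doubling, then so is $H$. -/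

import Mathlib

open Set MeasureTheory Bundle Manifold
open scoped ENNReal NNReal ContDiff RightActions

noncomputable section

/-- Smooth Riemannian metrics on an `n`-dimensional smooth manifold `X`. -/
abbrev RiemMetric (n : ℕ) (X : Type*) [TopologicalSpace X]
    [ChartedSpace (EuclideanSpace ℝ (Fin n)) X] [IsManifold (𝓡 n) ∞ X] :=
  ContMDiffRiemannianMetric (𝓡 n) ∞ (EuclideanSpace ℝ (Fin n))
    (fun x : X ↦ TangentSpace (𝓡 n) x)

/-- The Riemannian distance `d_g`: the infimum of the `g`-lengths of `C¹` paths. -/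
def riemDist {n : ℕ} {X : Type*} [TopologicalSpace X]
    [ChartedSpace (EuclideanSpace ℝ (Fin n)) X] [IsManifold (𝓡 n) ∞ X]
    (g : RiemMetric n X) (x y : X) : ℝ≥0∞ :=
  letI : RiemannianBundle (fun x : X ↦ TangentSpace (𝓡 n) x) := ⟨g.toRiemannianMetric⟩
  riemannianEDist (𝓡 n) x y

/-- The Gram matrix `g(∂ᵢ, ∂ⱼ)` of the coordinate vector fields of the chart at `x`, at the point
with coordinates `z`. -/
def chartGram {n : ℕ} {X : Type*} [TopologicalSpace X]
    [ChartedSpace (EuclideanSpace ℝ (Fin n)) X] [IsManifold (𝓡 n) ∞ X]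
    (g : RiemMetric n X) (x : X) (z : EuclideanSpace ℝ (Fin n)) : Matrix (Fin n) (Fin n) ℝ :=
  Matrix.of fun i j ↦ g.inner ((extChartAt (𝓡 n) x).symm z)
    (mfderiv (𝓡 n) (𝓡 n) (extChartAt (𝓡 n) x).symm z (EuclideanSpace.single i (1 : ℝ)))
    (mfderiv (𝓡 n) (𝓡 n) (extChartAt (𝓡 n) x).symm z (EuclideanSpace.single j (1 : ℝ)))

/-- The measure `√(det g) dz` on the domain of the chart at `x`, extended by zero to `X`. -/
def chartVolume {n : ℕ} {X : Type*} [TopologicalSpace X]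
    [ChartedSpace (EuclideanSpace ℝ (Fin n)) X] [IsManifold (𝓡 n) ∞ X] [MeasurableSpace X]
    (g : RiemMetric n X) (x : X) : Measure X :=
  (((volume : Measure (EuclideanSpace ℝ (Fin n))).restrict
      (extChartAt (𝓡 n) x).target).withDensity
    fun z ↦ ENNReal.ofReal √(chartGram g x z).det).map (extChartAt (𝓡 n) x).symm

/-- The Riemannian volume measure `μ_g`. The measures `chartVolume g x` agree on the overlaps of
chart domains, and their supremum in the lattice of measures is the measure on `X` that restricts
to `√(det g) dz` on each chart domain. -/
def riemVolume {n : ℕ} {X : Type*} [TopologicalSpace X]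
    [ChartedSpace (EuclideanSpace ℝ (Fin n)) X] [IsManifold (𝓡 n) ∞ X] [MeasurableSpace X]
    (g : RiemMetric n X) : Measure X :=
  ⨆ x : X, chartVolume g x

/-- The volume doubling constant `D(X, d, ν) = sup_{x, r > 0} ν(B(x, 2r)) / ν(B(x, r))`, with
closed balls `B(x, r)`. -/
def doublingConst {X : Type*} [MeasurableSpace X] (d : X → X → ℝ≥0∞) (ν : Measure X) : ℝ≥0∞ :=
  ⨆ (x : X) (r : ℝ) (_ : 0 < r),
    ν {y | d x y ≤ ENNReal.ofReal (2 * r)} / ν {y | d x y ≤ ENNReal.ofReal r}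

/-- Left-invariance of a Riemannian metric on a Lie group. -/
def IsLeftInvariantMetric {n : ℕ} {G : Type*} [TopologicalSpace G]
    [ChartedSpace (EuclideanSpace ℝ (Fin n)) G] [IsManifold (𝓡 n) ∞ G] [Group G]
    (g : RiemMetric n G) : Prop :=
  ∀ (σ x : G) (v w : TangentSpace (𝓡 n) x),
    g.inner (σ * x) (mfderiv (𝓡 n) (𝓡 n) (fun y ↦ σ * y) x v)
      (mfderiv (𝓡 n) (𝓡 n) (fun y ↦ σ * y) x w) = g.inner x v w

/-- A set `𝓛` of metrics is uniformly doubling, each metric `g` being taken with its Riemannian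
distance and its Riemannian volume measure. -/
def UniformlyDoublingOn {n : ℕ} {X : Type*} [TopologicalSpace X]
    [ChartedSpace (EuclideanSpace ℝ (Fin n)) X] [IsManifold (𝓡 n) ∞ X] [MeasurableSpace X]
    (𝓛 : Set (RiemMetric n X)) : Prop :=
  ∃ C : ℝ≥0, ∀ g ∈ 𝓛, doublingConst (riemDist g) (riemVolume g) ≤ C

/-- A Lie group is uniformly doubling if the set of all its left-invariant metrics is. -/
def IsUniformlyDoubling (n : ℕ) (G : Type*) [TopologicalSpace G]
    [ChartedSpace (EuclideanSpace ℝ (Fin n)) G] [IsManifold (𝓡 n) ∞ G] [Group G]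
    [MeasurableSpace G] : Prop :=
  UniformlyDoublingOn {g : RiemMetric n G | IsLeftInvariantMetric g}

/-- `f : X → Y` is a smooth submersion. -/
def IsSmoothSubmersion (n m : ℕ) {X Y : Type*} [TopologicalSpace X]
    [ChartedSpace (EuclideanSpace ℝ (Fin n)) X] [TopologicalSpace Y]
    [ChartedSpace (EuclideanSpace ℝ (Fin m)) Y] (f : X → Y) : Prop :=
  ContMDiff (𝓡 n) (𝓡 m) ∞ f ∧ ∀ x, Function.Surjective (mfderiv (𝓡 n) (𝓡 m) f x)

/-- `f : (X, g) → (Y, h)` is a Riemannian submersion: a smooth submersion whose differential is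
isometric on the orthogonal complement of its kernel. -/
def IsRiemannianSubmersion {n m : ℕ} {X Y : Type*} [TopologicalSpace X]
    [ChartedSpace (EuclideanSpace ℝ (Fin n)) X] [IsManifold (𝓡 n) ∞ X] [TopologicalSpace Y]
    [ChartedSpace (EuclideanSpace ℝ (Fin m)) Y] [IsManifold (𝓡 m) ∞ Y]
    (g : RiemMetric n X) (h : RiemMetric m Y) (f : X → Y) : Prop :=
  IsSmoothSubmersion n m f ∧
  ∀ (x : X) (v w : TangentSpace (𝓡 n) x),
    (∀ u : TangentSpace (𝓡 n) x, mfderiv (𝓡 n) (𝓡 m) f x u = 0 → g.inner x v u = 0) →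
    (∀ u : TangentSpace (𝓡 n) x, mfderiv (𝓡 n) (𝓡 m) f x u = 0 → g.inner x w u = 0) →
    h.inner (f x) (mfderiv (𝓡 n) (𝓡 m) f x v) (mfderiv (𝓡 n) (𝓡 m) f x w) = g.inner x v w

end

/-! ### Volume ratios under a measure-preserving transitive right action -/

/-! The core is a volume comparison for a transitive, measure-preserving right action of a
unimodular group. Let V(r) be the Haar measure of the ball B(r) about 1 in G. The claim is V(r)
ν(B(p,2r)) ≤ ν(B(p,r)) V(4r); applying doubling twice, V(4r) ≤ D² V(r), then gives the bound D².

To prove it, push the restrictions of μ to B(r) and B(4r) forward under the orbit map of p, with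
densities F and F' relative to ν. Right invariance of μ and B(r)B(3r) ⊆ B(4r) give F(y) ≤ F'(yσ) for
σ ∈ B(3r). Every point of B(p,2r) is reached from each y ∈ B(p,r) by such a σ, so F(y) ν(B(p,2r)) ≤
∫ F' ≤ V(4r). Integrating over y ∈ B(p,r), where F has total mass V(r), gives the claim. Null sets
and unattained infima cost a margin δ, which tends to 0. This is `measure_mul_measure_le_of_action`
and `doublingConst_le_sq_of_action`.

The geometric input is that d_h is the quotient of d_g: a Riemannian submersion does not increase
distances, and `IsRiemannianSubmersion.exists_lift_of_riemDist_lt` gives the converse. For group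
quotients one also needs that the Riemannian volume of a left-invariant metric is a Haar measure, by
change of variables in charts, and that every left-invariant metric on H comes from one on G. -/

section RightAction

variable {G M : Type*} [Group G] [MeasurableSpace G] [MeasurableMul₂ G] [MeasurableSpace M]
  {μ : Measure G} [SFinite μ] {ν : Measure M} [SigmaFinite ν] {a : M → G → M}

/-- Fubini for the set of pairs (x, σ) with σ ∈ W and xσ ∈ B: by invariance of ν, each slice at
fixed σ ∈ W has measure ν(B). -/
theorem measure_mul_measure_eq_lintegral_of_action {G M : Type*} [MeasurableSpace G]
    [MeasurableSpace M] {μ : Measure G} [SFinite μ] {ν : Measure M} [SigmaFinite ν] {a : M → G → M}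
    (ha : Measurable fun q : M × G ↦ a q.1 q.2) (hν : ∀ σ, ν.map (fun x ↦ a x σ) = ν)
    {W : Set G} (hW : MeasurableSet W) {B : Set M} (hB : MeasurableSet B) :
    μ W * ν B = ∫⁻ x, μ (W ∩ {σ | a x σ ∈ B}) ∂ν := by
  have hS : MeasurableSet {q : M × G | q.2 ∈ W ∧ a q.1 q.2 ∈ B} :=
    (measurable_snd hW).inter (ha hB)
  have h1 := Measure.prod_apply (μ := ν) (ν := μ) hS
  have h2 := Measure.prod_apply_symm (μ := ν) (ν := μ) hS
  have h3 : ∀ σ, ν ((fun x ↦ (x, σ)) ⁻¹' {q : M × G | q.2 ∈ W ∧ a q.1 q.2 ∈ B})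
      = W.indicator (fun _ ↦ ν B) σ := by
    intro σ
    by_cases hσ : σ ∈ W
    · have hm : Measurable fun x ↦ a x σ := ha.comp (measurable_id.prodMk measurable_const)
      rw [indicator_of_mem hσ]
      conv_rhs => rw [← hν σ, Measure.map_apply hm hB]
      congr 1
      ext x
      simp [hσ]
    · simp [hσ]
  rw [h1] at h2
  simp_rw [h3] at h2
  rw [lintegral_indicator hW, setLIntegral_const, mul_comm] at h2
  exact h2.symm

/-- Absolute continuity of orbit-map push-forwards. By Fubini the claim holds for almost every base
point, hence for one, as ν ≠ 0; left invariance of μ moves it to p. -/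
theorem measure_orbit_preimage_eq_zero [μ.IsMulLeftInvariant] [NeZero ν]
    (ha : Measurable fun q : M × G ↦ a q.1 q.2) (hν : ∀ σ, ν.map (fun x ↦ a x σ) = ν)
    (hmul : ∀ x σ τ, a x (σ * τ) = a (a x σ) τ) (htrans : ∀ x y, ∃ σ, a x σ = y)
    (p : M) {B : Set M} (hB : MeasurableSet B) (h0 : ν B = 0) :
    μ {σ | a p σ ∈ B} = 0 := by
  have h := measure_mul_measure_eq_lintegral_of_action (μ := μ) ha hν MeasurableSet.univ hB
  rw [h0, mul_zero] at h
  have hS : MeasurableSet {q : M × G | a q.1 q.2 ∈ B} := ha hB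
  have hm : Measurable fun x ↦ μ (univ ∩ {σ | a x σ ∈ B}) := by
    simpa using measurable_measure_prodMk_left (ν := μ) hS
  have h' := (lintegral_eq_zero_iff hm).1 h.symm
  obtain ⟨x, hx⟩ := h'.exists
  obtain ⟨τ, rfl⟩ := htrans p x
  have : {σ | a (a p τ) σ ∈ B} = (fun σ ↦ τ * σ) ⁻¹' {σ | a p σ ∈ B} := by
    ext σ; simp [hmul]
  simp only [univ_inter, Pi.zero_apply] at hx
  rwa [this, measure_preimage_mul] at hx

/-- A set `N` that is avoided by almost every small translate of `y` is null in a slightly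
smaller region. -/
theorem measure_inter_eq_zero_of_action [μ.IsMulLeftInvariant]
    (ha : Measurable fun q : M × G ↦ a q.1 q.2) (hν : ∀ σ, ν.map (fun x ↦ a x σ) = ν)
    (hmul : ∀ x σ τ, a x (σ * τ) = a (a x σ) τ) (h_one : ∀ x, a x 1 = x)
    {y : M} {N Y : Set M} (hN : MeasurableSet N) (hY : MeasurableSet Y) {S W : Set G}
    (hW : MeasurableSet W) (hW0 : μ W ≠ 0)
    (hYS : ∀ z ∈ Y, ∃ ξ, a y ξ = z ∧ ∀ σ ∈ W, ∀ τ ∈ W, ξ * σ⁻¹ * τ ∈ S)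
    (h0 : μ (S ∩ {σ | a y σ ∈ N}) = 0) : ν (N ∩ Y) = 0 := by
  have h := measure_mul_measure_eq_lintegral_of_action (μ := μ) ha hν hW (hN.inter hY)
  -- If one σ ∈ W takes x to yξ ∈ Y, then x = yξσ⁻¹, so left translation by ξσ⁻¹ carries the whole
  -- set into the null set of those elements of S that send y into N.
  have h' : ∀ x, μ (W ∩ {σ | a x σ ∈ N ∩ Y}) = 0 := by
    intro x
    by_cases hx : ∃ σ ∈ W, a x σ ∈ N ∩ Y
    · obtain ⟨σ, hσ, -, hz⟩ := hx
      obtain ⟨ξ, hξ, hS⟩ := hYS _ hz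
      have hx : x = a y (ξ * σ⁻¹) := by rw [hmul, hξ, ← hmul, mul_inv_cancel, h_one]
      refine measure_mono_null (t := (fun τ ↦ (ξ * σ⁻¹) * τ) ⁻¹' (S ∩ {σ | a y σ ∈ N})) ?_ ?_
      · rintro τ ⟨hτ, hτN, -⟩
        refine ⟨hS σ hσ τ hτ, ?_⟩
        rw [hx, ← hmul] at hτN
        exact hτN
      · rw [measure_preimage_mul, h0]
    · have : W ∩ {σ | a x σ ∈ N ∩ Y} = ∅ := by
        ext σ
        simp only [mem_inter_iff, mem_ofPred_eq, mem_empty_iff_false, iff_false]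
        exact fun hσ ↦ hx ⟨σ, hσ.1, hσ.2⟩
      rw [this, measure_empty]
  simp only [h', lintegral_zero, mul_eq_zero] at h
  exact h.resolve_left hW0

/-- A is carried into X by the orbit map, A·S ⊆ A', and S moves any point of X to any point of Y
with room to spare, measured by W. The room is needed because densities are only defined almost
everywhere. -/
theorem measure_mul_measure_le_of_action [μ.IsMulLeftInvariant] [μ.IsMulRightInvariant]
    (ha : Measurable fun q : M × G ↦ a q.1 q.2) (hν : ∀ σ, ν.map (fun x ↦ a x σ) = ν)
    (hmul : ∀ x σ τ, a x (σ * τ) = a (a x σ) τ) (h_one : ∀ x, a x 1 = x)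
    (htrans : ∀ x y, ∃ σ, a x σ = y) (p : M) {X Y : Set M} (hX : MeasurableSet X)
    (hY : MeasurableSet Y) {A A' S W : Set G} (hS : MeasurableSet S) (hW : MeasurableSet W) (hW0 : μ W ≠ 0)
    (hAX : ∀ σ ∈ A, a p σ ∈ X) (hAS : ∀ σ ∈ A, ∀ τ ∈ S, σ * τ ∈ A')
    (hXY : ∀ x ∈ X, ∀ y ∈ Y, ∃ ξ, a x ξ = y ∧ ∀ σ ∈ W, ∀ τ ∈ W, ξ * σ⁻¹ * τ ∈ S) :
    μ A * ν Y ≤ ν X * μ A' := by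
  rcases eq_zero_or_neZero ν with rfl | hne
  · simp
  have hp : Measurable (a p) := ha.comp (measurable_const.prodMk measurable_id)
  have hr : ∀ σ, Measurable fun x ↦ a x σ := fun σ ↦
    ha.comp (measurable_id.prodMk measurable_const)
  have hac : ∀ A : Set G, (μ.restrict A).map (a p) ≪ ν := by
    intro A
    refine Measure.AbsolutelyContinuous.mk fun B hB h0 ↦ ?_
    rw [Measure.map_apply hp hB]
    exact Measure.restrict_le_self.absolutelyContinuous
      (measure_orbit_preimage_eq_zero (μ := μ) ha hν hmul htrans p hB h0)
  set F := ((μ.restrict A).map (a p)).rnDeriv ν with hFdef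
  set F' := ((μ.restrict A').map (a p)).rnDeriv ν with hF'def
  have hF : ν.withDensity F = (μ.restrict A).map (a p) := Measure.withDensity_rnDeriv_eq _ _ (hac A)
  have hF' : ν.withDensity F' = (μ.restrict A').map (a p) :=
    Measure.withDensity_rnDeriv_eq _ _ (hac A')
  have hFm : Measurable F := Measure.measurable_rnDeriv _ _
  have hFm' : Measurable F' := Measure.measurable_rnDeriv _ _
  -- Right translation by σ preserves μ and maps A into A', so the mass of A over B is at most the
  -- mass of A' over Bσ. This is where unimodularity enters.
  have key : ∀ σ ∈ S, ∀ᵐ y ∂ν, F y ≤ F' (a y σ) := by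
    intro σ hσ
    refine ae_le_of_forall_setLIntegral_le_of_sigmaFinite hFm fun B hB _ ↦ ?_
    rw [← withDensity_apply _ hB, hF, Measure.map_apply hp hB,
      Measure.restrict_apply (hp hB)]
    have hB' : MeasurableSet ((fun x ↦ a x σ⁻¹) ⁻¹' B) := hr σ⁻¹ hB
    have e1 : ∫⁻ y in B, F' (a y σ) ∂ν = ∫⁻ y in (fun x ↦ a x σ⁻¹) ⁻¹' B, F' y ∂ν := by
      conv_rhs => rw [← hν σ, setLIntegral_map hB' hFm' (hr σ)]
      congr 2
      ext y
      simp [← hmul, h_one]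
    rw [e1, ← withDensity_apply _ hB', hF', Measure.map_apply hp hB',
      Measure.restrict_apply (hp hB'),
      ← measure_preimage_mul_right μ σ (a p ⁻¹' ((fun x ↦ a x σ⁻¹) ⁻¹' B) ∩ A')]
    refine measure_mono ?_
    rintro τ ⟨hτ, hτA⟩
    refine ⟨?_, hAS τ hτA σ hσ⟩
    simpa [← hmul] using hτ
  -- The exceptional null set of y depends on σ; Fubini exchanges the two quantifiers.
  have key2 : ∀ᵐ y ∂ν, ∀ᵐ σ ∂μ, σ ∈ S → F y ≤ F' (a y σ) := by
    have hms : MeasurableSet {q : M × G | q.2 ∈ S → F q.1 ≤ F' (a q.1 q.2)} := by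
      have : {q : M × G | q.2 ∈ S → F q.1 ≤ F' (a q.1 q.2)} =
          (Prod.snd ⁻¹' S)ᶜ ∪ {q | F q.1 ≤ F' (a q.1 q.2)} := by
        ext q; simp [imp_iff_not_or]
      rw [this]
      exact (measurable_snd hS).compl.union
        (measurableSet_le (hFm.comp measurable_fst) (hFm'.comp ha))
    rw [Measure.ae_ae_comm hms]
    refine Filter.Eventually.of_forall fun σ ↦ ?_
    by_cases hσ : σ ∈ S
    · filter_upwards [key σ hσ] with y hy _ using hy
    · simp [hσ]
  -- Almost every σ ∈ S sends y to a point where F' ≥ F y, so F' ≥ F y almost everywhere on Y, and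
  -- F' has total mass μ A'.
  have key3 : ∀ᵐ y ∂ν, y ∈ X → F y * ν Y ≤ μ A' := by
    filter_upwards [key2] with y hy hyX
    have hN : MeasurableSet {z | F' z < F y} := measurableSet_lt hFm' measurable_const
    have h0 : ν ({z | F' z < F y} ∩ Y) = 0 := by
      refine measure_inter_eq_zero_of_action (μ := μ) ha hν hmul h_one hN hY hW hW0
        (hXY y hyX) (S := S) ?_
      rw [ae_iff] at hy
      refine measure_mono_null ?_ hy
      rintro σ ⟨hσ, hσN⟩
      simpa [hσ] using hσN
    calc F y * ν Y = ∫⁻ _ in Y, F y ∂ν := by rw [setLIntegral_const]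
      _ ≤ ∫⁻ z in Y, F' z ∂ν := by
          refine lintegral_mono_ae ?_
          rw [ae_restrict_iff' hY, ae_iff]
          refine measure_mono_null ?_ h0
          intro z hz
          simp only [mem_ofPred_eq, Classical.not_imp, not_le] at hz
          exact ⟨hz.2, hz.1⟩
      _ = μ.restrict A' ((a p) ⁻¹' Y) := by
          rw [← withDensity_apply _ hY, hF', Measure.map_apply hp hY]
      _ ≤ μ A' := (measure_mono (subset_univ _)).trans (by simp)
  have hAν : μ A = ∫⁻ y in X, F y ∂ν := by
    rw [← withDensity_apply _ hX, hF, Measure.map_apply hp hX, Measure.restrict_apply (hp hX)]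
    congr 1
    ext σ
    exact ⟨fun h ↦ ⟨hAX σ h, h⟩, fun h ↦ h.2⟩
  calc μ A * ν Y = ∫⁻ y in X, F y * ν Y ∂ν := by rw [lintegral_mul_const _ hFm, hAν]
    _ ≤ ∫⁻ _ in X, μ A' ∂ν := by
        refine lintegral_mono_ae ?_
        rwa [ae_restrict_iff' hX]
    _ = ν X * μ A' := by rw [setLIntegral_const, mul_comm]

/-- The doubling constant of a space on which `G` acts transitively, preserving the measure, with a
distance that is the quotient of a left-invariant distance on `G`. -/
theorem doublingConst_le_sq_of_action [μ.IsMulLeftInvariant] [μ.IsMulRightInvariant]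
    (ha : Measurable fun q : M × G ↦ a q.1 q.2) (hν : ∀ σ, ν.map (fun x ↦ a x σ) = ν)
    (hmul : ∀ x σ τ, a x (σ * τ) = a (a x σ) τ) (h_one : ∀ x, a x 1 = x)
    (htrans : ∀ x y, ∃ σ, a x σ = y) {d : M → M → ℝ≥0∞} {dG : G → G → ℝ≥0∞}
    (hd : ∀ x, Measurable (d x)) (hdG : Measurable (dG 1))
    (hinv : ∀ σ x y, dG (σ * x) (σ * y) = dG x y) (hcomm : ∀ x y, dG x y = dG y x)
    (htri : ∀ x y z, dG x z ≤ dG x y + dG y z)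
    (hpos : ∀ r : ℝ, 0 < r → μ {σ | dG 1 σ ≤ ENNReal.ofReal r} ≠ 0)
    (hfin : ∃ r : ℝ, 0 < r ∧ μ {σ | dG 1 σ ≤ ENNReal.ofReal r} ≠ ⊤)
    (hle : ∀ x σ, d x (a x σ) ≤ dG 1 σ)
    (hlift : ∀ x y s, d x y < s → ∃ σ, a x σ = y ∧ dG 1 σ < s) :
    doublingConst d ν ≤ doublingConst dG μ ^ 2 := by
  set D := doublingConst dG μ with hD
  by_cases hDtop : D = ⊤
  · simp [hDtop]
  have hℓmul : ∀ σ τ, dG 1 (σ * τ) ≤ dG 1 σ + dG 1 τ := fun σ τ ↦ by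
    have h := htri 1 σ (σ * τ)
    have h' := hinv σ 1 τ
    rw [mul_one] at h'
    rwa [h'] at h
  have hℓinv : ∀ σ, dG 1 σ⁻¹ = dG 1 σ := fun σ ↦ by
    have h' := hinv σ 1 σ⁻¹
    rw [mul_one, mul_inv_cancel] at h'
    rw [← h', hcomm]
  let V : ℝ → ℝ≥0∞ := fun r ↦ μ {σ | dG 1 σ ≤ ENNReal.ofReal r}
  have hVm : ∀ r : ℝ, MeasurableSet {σ | dG 1 σ ≤ ENNReal.ofReal r} := fun r ↦
    measurableSet_le hdG measurable_const
  have hVmono : Monotone V := fun r s hrs ↦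
    measure_mono fun σ hσ ↦ le_trans hσ (ENNReal.ofReal_le_ofReal hrs)
  -- Finiteness is required because a quotient by ⊤ is 0 in `ℝ≥0∞`, so a ball of infinite volume
  -- puts no constraint on D.
  have hdoub : ∀ r : ℝ, 0 < r → V r ≠ ⊤ → V (2 * r) ≤ D * V r := by
    intro r hr hfr
    have h : V (2 * r) / V r ≤ D := by
      rw [hD]
      exact le_iSup_of_le (1 : G) (le_iSup_of_le r (le_iSup_of_le hr le_rfl))
    rwa [ENNReal.div_le_iff (hpos r hr) hfr] at h
  -- One ball has finite volume, and doubling with finite D propagates this to all radii; no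
  -- compactness of large balls is needed.
  have hVfin : ∀ r, V r ≠ ⊤ := by
    obtain ⟨r₀, hr₀, hf₀⟩ := hfin
    have hk : ∀ k : ℕ, V (2 ^ k * r₀) ≠ ⊤ := by
      intro k
      induction k with
      | zero => simpa using hf₀
      | succ k ih =>
        have h := hdoub (2 ^ k * r₀) (by positivity) ih
        rw [← mul_assoc, ← pow_succ'] at h
        exact ne_top_of_le_ne_top (ENNReal.mul_ne_top hDtop ih) h
    intro r
    obtain ⟨k, hk'⟩ := pow_unbounded_of_one_lt (r / r₀) (one_lt_two : (1 : ℝ) < 2)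
    exact ne_top_of_le_ne_top (hk k) (hVmono ((div_le_iff₀ hr₀).1 hk'.le))
  refine iSup_le fun p ↦ iSup_le fun r ↦ iSup_le fun hr ↦ ENNReal.div_le_of_le_mul ?_
  set X := {y | d p y ≤ ENNReal.ofReal r}
  set Y := {y | d p y ≤ ENNReal.ofReal (2 * r)}
  have hstep : ∀ δ : ℝ, 0 < δ → V r * ν Y ≤ ν X * V (4 * r + 4 * δ) := by
    intro δ hδ
    have hadd : ∀ {s t : ℝ} {σ τ : G}, 0 ≤ s → 0 ≤ t → dG 1 σ ≤ ENNReal.ofReal s →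
        dG 1 τ ≤ ENNReal.ofReal t → dG 1 (σ * τ) ≤ ENNReal.ofReal (s + t) := by
      intro s t σ τ hs ht h h'
      rw [ENNReal.ofReal_add hs ht]
      exact (hℓmul σ τ).trans (add_le_add h h')
    -- The radius 3r + 4δ is (r + δ) + (2r + δ) for going from x back to p and on to y by almost
    -- minimal lifts, plus 2δ for the two factors from W.
    refine measure_mul_measure_le_of_action (S := {σ | dG 1 σ ≤ ENNReal.ofReal (3 * r + 4 * δ)})
      (W := {σ | dG 1 σ ≤ ENNReal.ofReal δ}) ha hν hmul h_one htrans p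
      (measurableSet_le (hd p) measurable_const) (measurableSet_le (hd p) measurable_const)
      (hVm _) (hVm _) (hpos δ hδ) (fun σ hσ ↦ (hle p σ).trans hσ) ?_ ?_
    · intro σ hσ τ hτ
      have h := hadd hr.le (by positivity) hσ hτ
      rwa [show r + (3 * r + 4 * δ) = 4 * r + 4 * δ by ring] at h
    · intro x hx y hy
      obtain ⟨η, rfl, hη⟩ := hlift p x (ENNReal.ofReal (r + δ))
        (lt_of_le_of_lt hx ((ENNReal.ofReal_lt_ofReal_iff (by positivity)).2 (by linarith)))
      obtain ⟨ζ, rfl, hζ⟩ := hlift p y (ENNReal.ofReal (2 * r + δ))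
        (lt_of_le_of_lt hy ((ENNReal.ofReal_lt_ofReal_iff (by positivity)).2 (by linarith)))
      refine ⟨η⁻¹ * ζ, by rw [← hmul, mul_inv_cancel_left], fun σ hσ τ hτ ↦ ?_⟩
      have hη' : dG 1 η⁻¹ ≤ ENNReal.ofReal (r + δ) := by rw [hℓinv]; exact hη.le
      have hσ' : dG 1 σ⁻¹ ≤ ENNReal.ofReal δ := by rw [hℓinv]; exact hσ
      have h := hadd (by positivity) hδ.le (hadd (by positivity) hδ.le
        (hadd (by positivity) (by positivity) hη' hζ.le) hσ') hτ
      rwa [show r + δ + (2 * r + δ) + δ + δ = 3 * r + 4 * δ by ring] at h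
  -- Continuity of μ from above: a closed ball is the intersection of the larger closed balls, which
  -- have finite volume.
  have hlim : Filter.Tendsto (fun k : ℕ ↦ V (4 * r + 4 * (1 / ((k : ℝ) + 1)))) Filter.atTop
      (nhds (V (4 * r))) := by
    have hInter : {σ | dG 1 σ ≤ ENNReal.ofReal (4 * r)} =
        ⋂ k : ℕ, {σ | dG 1 σ ≤ ENNReal.ofReal (4 * r + 4 * (1 / ((k : ℝ) + 1)))} := by
      have hl : Filter.Tendsto (fun k : ℕ ↦ ENNReal.ofReal (4 * r + 4 * (1 / ((k : ℝ) + 1))))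
          Filter.atTop (nhds (ENNReal.ofReal (4 * r))) := by
        have := (tendsto_one_div_add_atTop_nhds_zero_nat (𝕜 := ℝ)).const_mul 4 |>.const_add (4 * r)
        rw [mul_zero, add_zero] at this
        exact ENNReal.tendsto_ofReal this
      ext σ
      simp only [mem_ofPred_eq, mem_iInter]
      refine ⟨fun h k ↦ h.trans (ENNReal.ofReal_le_ofReal ?_), fun h ↦ ge_of_tendsto' hl h⟩
      have : (0 : ℝ) < 1 / ((k : ℝ) + 1) := by positivity
      linarith
    change Filter.Tendsto _ _ (nhds (μ {σ | dG 1 σ ≤ ENNReal.ofReal (4 * r)}))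
    rw [hInter]
    refine tendsto_measure_iInter_atTop (fun k ↦ (hVm _).nullMeasurableSet) ?_ ⟨0, hVfin _⟩
    intro i j hij σ hσ
    refine le_trans hσ (ENNReal.ofReal_le_ofReal ?_)
    have : 1 / ((j : ℝ) + 1) ≤ 1 / ((i : ℝ) + 1) := one_div_le_one_div_of_le (by positivity)
      (by exact_mod_cast Nat.succ_le_succ hij)
    linarith
  have hmain : V r * ν Y ≤ ν X * V (4 * r) :=
    ge_of_tendsto' (ENNReal.Tendsto.const_mul hlim (Or.inl (hpos _ (by positivity))))
      fun k ↦ hstep _ (by positivity)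
  have h4 : V (4 * r) ≤ D ^ 2 * V r := by
    have h1 := hdoub r hr (hVfin r)
    have h2 := hdoub (2 * r) (by positivity) (hVfin _)
    rw [show 2 * (2 * r) = 4 * r by ring] at h2
    calc V (4 * r) ≤ D * V (2 * r) := h2
      _ ≤ D * (D * V r) := by gcongr
      _ = D ^ 2 * V r := by ring
  refine (ENNReal.mul_le_mul_iff_right (hpos r hr) (hVfin r)).1 ?_
  calc V r * ν Y ≤ ν X * V (4 * r) := hmain
    _ ≤ ν X * (D ^ 2 * V r) := by gcongr
    _ = V r * (D ^ 2 * ν X) := by ring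

end RightAction

/-! ### The Riemannian distance -/

section RiemDist

variable {n m : ℕ} {X Y : Type*} [TopologicalSpace X] [ChartedSpace (EuclideanSpace ℝ (Fin n)) X]
  [IsManifold (𝓡 n) ∞ X] [TopologicalSpace Y] [ChartedSpace (EuclideanSpace ℝ (Fin m)) Y]
  [IsManifold (𝓡 m) ∞ Y] (g : RiemMetric n X) (h : RiemMetric m Y)

/-- The speed of a curve with respect to a Riemannian metric. -/
noncomputable def riemSpeed (γ : ℝ → X) (t : ℝ) : ℝ :=
  √(g.inner (γ t) (mfderiv 𝓘(ℝ, ℝ) (𝓡 n) γ t (1 : ℝ)) (mfderiv 𝓘(ℝ, ℝ) (𝓡 n) γ t (1 : ℝ)))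

theorem riemMetric_nonneg (x : X) (v : TangentSpace (𝓡 n) x) : 0 ≤ g.inner x v v := by
  rcases eq_or_ne v 0 with rfl | hv
  · simp
  · exact (g.pos x v hv).le

theorem pathELength_eq_lintegral_riemSpeed (γ : ℝ → X) (a b : ℝ) :
    letI : RiemannianBundle (fun x : X ↦ TangentSpace (𝓡 n) x) := ⟨g.toRiemannianMetric⟩
    pathELength (𝓡 n) γ a b = ∫⁻ t in Icc a b, ENNReal.ofReal (riemSpeed g γ t) := by
  let : RiemannianBundle (fun x : X ↦ TangentSpace (𝓡 n) x) := ⟨g.toRiemannianMetric⟩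
  rw [pathELength_eq_lintegral_mfderiv_Icc]
  congr 1
  ext t
  rw [← ofReal_norm, norm_eq_sqrt_real_inner]
  rfl

theorem riemDist_le_lintegral_riemSpeed {γ : ℝ → X} {a b : ℝ}
    (hγ : ContMDiffOn 𝓘(ℝ, ℝ) (𝓡 n) 1 γ (Icc a b)) (hab : a ≤ b) :
    riemDist g (γ a) (γ b) ≤ ∫⁻ t in Icc a b, ENNReal.ofReal (riemSpeed g γ t) := by
  let : RiemannianBundle (fun x : X ↦ TangentSpace (𝓡 n) x) := ⟨g.toRiemannianMetric⟩
  rw [← pathELength_eq_lintegral_riemSpeed]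
  exact riemannianEDist_le_pathELength hγ rfl rfl hab

theorem exists_path_of_riemDist_lt {x y : X} {r : ℝ≥0∞} (hr : riemDist g x y < r) :
    ∃ γ : ℝ → X, γ 0 = x ∧ γ 1 = y ∧ ContMDiff 𝓘(ℝ, ℝ) (𝓡 n) 1 γ ∧
      ∫⁻ t in Icc 0 1, ENNReal.ofReal (riemSpeed g γ t) < r := by
  let : RiemannianBundle (fun x : X ↦ TangentSpace (𝓡 n) x) := ⟨g.toRiemannianMetric⟩
  obtain ⟨γ, h0, h1, hγ, hl, -⟩ :=
    exists_lt_locally_constant_of_riemannianEDist_lt (I := 𝓡 n) hr zero_lt_one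
  exact ⟨γ, h0, h1, hγ, by rwa [← pathELength_eq_lintegral_riemSpeed]⟩

theorem riemDist_self (x : X) : riemDist g x x = 0 := by
  let : RiemannianBundle (fun x : X ↦ TangentSpace (𝓡 n) x) := ⟨g.toRiemannianMetric⟩
  exact riemannianEDist_self

theorem riemDist_comm (x y : X) : riemDist g x y = riemDist g y x := by
  let : RiemannianBundle (fun x : X ↦ TangentSpace (𝓡 n) x) := ⟨g.toRiemannianMetric⟩
  exact riemannianEDist_comm

theorem riemDist_triangle (x y z : X) : riemDist g x z ≤ riemDist g x y + riemDist g y z := by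
  let : RiemannianBundle (fun x : X ↦ TangentSpace (𝓡 n) x) := ⟨g.toRiemannianMetric⟩
  exact riemannianEDist_triangle

theorem eventually_riemDist_lt (x : X) {c : ℝ≥0∞} (hc : 0 < c) :
    ∀ᶠ y in nhds x, riemDist g x y < c := by
  let : RiemannianBundle (fun x : X ↦ TangentSpace (𝓡 n) x) := ⟨g.toRiemannianMetric⟩
  have : IsContinuousRiemannianBundle (EuclideanSpace ℝ (Fin n))
      (fun x : X ↦ TangentSpace (𝓡 n) x) :=
    ⟨⟨g.inner, g.contMDiff.continuous, fun _ _ _ ↦ rfl⟩⟩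
  have : IsManifold (𝓡 n) 1 X := IsManifold.of_le (n := ∞) (by simp)
  exact eventually_riemannianEDist_lt (𝓡 n) x hc

theorem exists_riemDist_lt_subset [T2Space X] (x : X) {s : Set X} (hs : s ∈ nhds x) :
    ∃ c > 0, {y | riemDist g x y < c} ⊆ s := by
  let : RiemannianBundle (fun x : X ↦ TangentSpace (𝓡 n) x) := ⟨g.toRiemannianMetric⟩
  have : IsContinuousRiemannianBundle (EuclideanSpace ℝ (Fin n))
      (fun x : X ↦ TangentSpace (𝓡 n) x) :=
    ⟨⟨g.inner, g.contMDiff.continuous, fun _ _ _ ↦ rfl⟩⟩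
  have : IsManifold (𝓡 n) 1 X := IsManifold.of_le (n := ∞) (by simp)
  have : LocallyCompactSpace X := Manifold.locallyCompact_of_finiteDimensional (𝓡 n)
  exact setOfPred_riemannianEDist_lt_subset_nhds' (𝓡 n) hs

theorem continuous_riemDist (x : X) : Continuous (riemDist g x) := by
  refine continuous_iff_continuousAt.2 fun y ↦ ?_
  have hle : ∀ z, riemDist g x z ≤ riemDist g x y + riemDist g y z := riemDist_triangle g x y
  have hle' : ∀ z, riemDist g x y ≤ riemDist g x z + riemDist g y z := fun z ↦ by
    rw [riemDist_comm g y z]; exact riemDist_triangle g x z y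
  by_cases htop : riemDist g x y = ⊤
  · have : ∀ᶠ z in nhds y, riemDist g x z = ⊤ := by
      filter_upwards [eventually_riemDist_lt g y (c := 1) one_pos] with z hz
      have := hle' z
      rw [htop, top_le_iff, ENNReal.add_eq_top] at this
      exact this.resolve_right (ne_top_of_lt hz)
    rw [ContinuousAt, htop]
    exact tendsto_const_nhds.congr' (this.mono fun _ h ↦ h.symm)
  · rw [ContinuousAt, ENNReal.tendsto_nhds htop]
    intro ε hε
    filter_upwards [eventually_riemDist_lt g y hε] with z hz
    exact ⟨tsub_le_iff_right.2 ((hle' z).trans (by gcongr)), (hle z).trans (by gcongr)⟩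

/-- The points at finite distance from x form a nonempty clopen set. -/
theorem riemDist_ne_top [ConnectedSpace X] (x y : X) : riemDist g x y ≠ ⊤ := by
  have hopen : IsOpen {z | riemDist g x z ≠ ⊤} :=
    isOpen_ne.preimage (continuous_riemDist g x)
  have hclosed : IsClosed {z | riemDist g x z ≠ ⊤} := by
    rw [← isOpen_compl_iff, isOpen_iff_mem_nhds]
    intro y hy
    simp only [mem_compl_iff, mem_ofPred_eq, not_not] at hy
    filter_upwards [eventually_riemDist_lt g y (c := 1) one_pos] with z hz
    simp only [mem_compl_iff, mem_ofPred_eq, not_not]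
    have := riemDist_triangle g x z y
    rw [hy, top_le_iff, ENNReal.add_eq_top, riemDist_comm g z y] at this
    exact this.resolve_right (ne_top_of_lt hz)
  have : {z | riemDist g x z ≠ ⊤} = univ :=
    IsClopen.eq_univ ⟨hclosed, hopen⟩ ⟨x, by simp [riemDist_self]⟩
  exact this.ge (mem_univ y)

variable {g h} in
/-- A `C¹` map whose differential does not increase norms does not increase distances. -/
theorem riemDist_map_le {F : X → Y} (hF : ContMDiff (𝓡 n) (𝓡 m) 1 F)
    (hle : ∀ x (v : TangentSpace (𝓡 n) x), h.inner (F x) (mfderiv (𝓡 n) (𝓡 m) F x v)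
      (mfderiv (𝓡 n) (𝓡 m) F x v) ≤ g.inner x v v) (x y : X) :
    riemDist h (F x) (F y) ≤ riemDist g x y := by
  refine le_of_forall_gt fun r hr ↦ ?_
  obtain ⟨γ, rfl, rfl, hγ, hl⟩ := exists_path_of_riemDist_lt g hr
  refine lt_of_le_of_lt ((riemDist_le_lintegral_riemSpeed h (hF.comp hγ).contMDiffOn
    zero_le_one).trans (lintegral_mono fun t ↦ ENNReal.ofReal_le_ofReal (Real.sqrt_le_sqrt ?_))) hl
  have := mfderiv_comp_apply (I := 𝓘(ℝ, ℝ)) (I' := 𝓡 n) (I'' := 𝓡 m) t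
    ((hF (γ t)).mdifferentiableAt one_ne_zero) ((hγ t).mdifferentiableAt one_ne_zero) (1 : ℝ)
  rw [this]
  exact hle (γ t) _

/-- The inner product of the images of two fixed vectors under the differential of a `C¹` map is
continuous. -/
theorem continuousOn_inner_mfderiv {E : Type*} [NormedAddCommGroup E] [NormedSpace ℝ E]
    {f : E → X} {u : Set E} (hu : IsOpen u) (hf : ContMDiffOn 𝓘(ℝ, E) (𝓡 n) 1 f u) (v w : E) :
    ContinuousOn (fun x ↦ g.inner (f x) (mfderiv 𝓘(ℝ, E) (𝓡 n) f x v)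
      (mfderiv 𝓘(ℝ, E) (𝓡 n) f x w)) u := by
  let : RiemannianBundle (fun x : X ↦ TangentSpace (𝓡 n) x) := ⟨g.toRiemannianMetric⟩
  have : IsContinuousRiemannianBundle (EuclideanSpace ℝ (Fin n))
      (fun x : X ↦ TangentSpace (𝓡 n) x) :=
    ⟨⟨g.inner, g.contMDiff.continuous, fun _ _ _ ↦ rfl⟩⟩
  have : IsManifold (𝓡 n) 1 X := IsManifold.of_le (n := ∞) (by simp)
  have key : ∀ v : E, ContinuousOn (fun x ↦ (TotalSpace.mk' (EuclideanSpace ℝ (Fin n)) (f x)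
      (mfderiv 𝓘(ℝ, E) (𝓡 n) f x v) : TangentBundle (𝓡 n) X)) u := by
    intro v
    have h1 := hf.continuousOn_tangentMapWithin le_rfl hu.uniqueMDiffOn
    have h2 : Continuous fun x : E ↦ (TotalSpace.mk' E x v : TangentBundle 𝓘(ℝ, E) E) := by
      rw [← (tangentBundleModelSpaceHomeomorph 𝓘(ℝ, E)).comp_continuous_iff]
      exact continuous_id.prodMk continuous_const
    refine (h1.comp h2.continuousOn fun x hx ↦ hx).congr fun x hx ↦ ?_
    simp only [Function.comp_apply, tangentMapWithin, mfderivWithin_of_isOpen hu hx]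
  exact (key v).inner_bundle (key w)

/-- The speed of a `C¹` curve is continuous. -/
theorem continuousAt_riemSpeed {γ : ℝ → X} {t : ℝ} (hγ : ContMDiffAt 𝓘(ℝ, ℝ) (𝓡 n) 1 γ t) :
    ContinuousAt (riemSpeed g γ) t := by
  obtain ⟨u, hu, hγu⟩ := contMDiffAt_iff_contMDiffOn_nhds (by simp) |>.1 hγ
  obtain ⟨w, hwu, hw, htw⟩ := mem_nhds_iff.1 hu
  exact ((continuousOn_inner_mfderiv g hw (hγu.mono hwu) 1 1).sqrt).continuousAt
    (hw.mem_nhds htw)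

end RiemDist

/-! ### Riemannian submersions -/

section Linear

variable {E F : Type*} [AddCommGroup E] [Module ℝ E] [TopologicalSpace E] [IsTopologicalAddGroup E]
  [ContinuousSMul ℝ E] [FiniteDimensional ℝ E] [AddCommGroup F]
  [Module ℝ F] [TopologicalSpace F] [IsTopologicalAddGroup F] [ContinuousSMul ℝ F] [T2Space F]
  [FiniteDimensional ℝ F]

/-- A surjective linear map has a right inverse with values in the orthogonal complement of its
kernel. -/
theorem exists_orthogonal_rightInverse (B : E →L[ℝ] E →L[ℝ] ℝ) (hsymm : ∀ v w, B v w = B w v)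
    (hpos : ∀ v, v ≠ 0 → 0 < B v v) (L : E →L[ℝ] F) (hL : Function.Surjective L) :
    ∃ A : F →L[ℝ] E, (∀ w, L (A w) = w) ∧ ∀ w u, L u = 0 → B (A w) u = 0 := by
  let b : LinearMap.BilinForm ℝ E := LinearMap.mk₂ ℝ (fun v w ↦ B v w) (by simp) (by simp)
    (by simp) (by simp)
  have hb : ∀ v w, b v w = B v w := fun _ _ ↦ rfl
  have hrefl : b.IsRefl := fun v w h ↦ by rw [hb] at h ⊢; rw [hsymm, h]
  have hdisj : Disjoint L.toLinearMap.ker (b.orthogonal L.toLinearMap.ker) := by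
    rw [Submodule.disjoint_def]
    intro v hv hv'
    by_contra h0
    exact (hpos v h0).ne' (hv' v hv)
  have hc := (LinearMap.BilinForm.isCompl_orthogonal_iff_disjoint hrefl).2 hdisj
  obtain ⟨S, hS⟩ := L.toLinearMap.exists_rightInverse_of_surjective
    (LinearMap.range_eq_top.2 hL)
  have hex : ∀ v : E, ∃ k : E, L k = 0 ∧ v - k ∈ b.orthogonal L.toLinearMap.ker := by
    intro v
    have hv : v ∈ L.toLinearMap.ker ⊔ b.orthogonal L.toLinearMap.ker := by
      rw [hc.sup_eq_top]; trivial
    obtain ⟨k, hk, o, ho, rfl⟩ := Submodule.mem_sup.1 hv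
    exact ⟨k, hk, by simpa using ho⟩
  -- Correcting an arbitrary right inverse S by the projection along the kernel changes its values
  -- only by kernel elements.
  let P := Submodule.projectionOnto _ _ hc.symm
  let A : F →ₗ[ℝ] E := (Submodule.subtype _).comp (P.comp S)
  refine ⟨LinearMap.toContinuousLinearMap A, fun w ↦ ?_, fun w u hu ↦ ?_⟩
  · obtain ⟨k, hk, ho⟩ := hex (S w)
    have h1 : A w = S w - k := by
      have h2 : P (S w) = P (S w - k) + P k := by rw [← map_add, sub_add_cancel]
      have h3 : P k = 0 := Submodule.projectionOnto_apply_of_mem_right hc.symm hk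
      have h4 : P (S w - k) = ⟨S w - k, ho⟩ :=
        Submodule.projectionOnto_apply_left hc.symm ⟨S w - k, ho⟩
      simp only [A, LinearMap.comp_apply, h2, h3, h4, add_zero, Submodule.subtype_apply]
    have h5 : L (S w) = w := LinearMap.congr_fun hS w
    change L (A w) = w
    rw [h1, map_sub, hk, sub_zero, h5]
  · have := (P (S w)).2 u hu
    change B (P (S w)) u = 0
    rw [hsymm]
    exact this

end Linear

section Submersion

variable {n m : ℕ} {X Y : Type*} [TopologicalSpace X] [ChartedSpace (EuclideanSpace ℝ (Fin n)) X]
  [IsManifold (𝓡 n) ∞ X] [TopologicalSpace Y] [ChartedSpace (EuclideanSpace ℝ (Fin m)) Y]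
  [IsManifold (𝓡 m) ∞ Y]

/-- A `C¹` map has a `C¹` local section with any prescribed right inverse of its differential as
differential. -/
theorem exists_local_section {f : X → Y} {x : X} (hf : ContMDiffAt (𝓡 n) (𝓡 m) 1 f x)
    (A : TangentSpace (𝓡 m) (f x) →L[ℝ] TangentSpace (𝓡 n) x)
    (hA : ∀ w, mfderiv (𝓡 n) (𝓡 m) f x (A w) = w) :
    ∃ s : Y → X, ContMDiffAt (𝓡 m) (𝓡 n) 1 s (f x) ∧ s (f x) = x ∧
      (∀ᶠ y in nhds (f x), f (s y) = y) ∧ mfderiv (𝓡 m) (𝓡 n) s (f x) = A := by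
  have : IsManifold (𝓡 n) 1 X := IsManifold.of_le (n := ∞) (by simp)
  have : IsManifold (𝓡 m) 1 Y := IsManifold.of_le (n := ∞) (by simp)
  let A' : EuclideanSpace ℝ (Fin m) →L[ℝ] EuclideanSpace ℝ (Fin n) := A
  let c := extChartAt (𝓡 n) x
  let c' := extChartAt (𝓡 m) (f x)
  let i : EuclideanSpace ℝ (Fin m) → EuclideanSpace ℝ (Fin n) := fun w ↦ c x + A' w
  let j : EuclideanSpace ℝ (Fin m) → X := fun w ↦ c.symm (i w)
  have hi0 : i 0 = c x := by simp [i]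
  have hj0 : j 0 = x := by simp only [j, hi0]; exact extChartAt_to_inv x
  have hi : ContMDiffAt (𝓡 m) (𝓡 n) 1 i 0 :=
    (contDiff_const.add A'.contDiff).contDiffAt.contMDiffAt
  have hi' : HasMFDerivAt (𝓡 m) (𝓡 n) i 0 A' :=
    (A'.hasFDerivAt.const_add (c x)).hasMFDerivAt
  have hcs : ContMDiffAt (𝓡 n) (𝓡 n) 1 c.symm (i 0) := by
    rw [hi0]
    exact (contMDiffOn_extChartAt_symm (I := 𝓡 n) (n := 1) x).contMDiffAt
      (extChartAt_target_mem_nhds x)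
  have hcs' : HasMFDerivAt (𝓡 n) (𝓡 n) c.symm (i 0)
      (ContinuousLinearMap.id ℝ (EuclideanSpace ℝ (Fin n))) := by
    have h1 := (hcs.mdifferentiableAt one_ne_zero).hasMFDerivAt
    have h2 := mfderivWithin_range_extChartAt_symm (I := 𝓡 n) (x := x)
    rw [ModelWithCorners.range_eq_univ, mfderivWithin_univ, ← hi0] at h2
    rwa [h2] at h1
  have hj : ContMDiffAt (𝓡 m) (𝓡 n) 1 j 0 := hcs.comp 0 hi
  have hj' : HasMFDerivAt (𝓡 m) (𝓡 n) j 0 A' := hcs'.comp 0 hi'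
  have hfj : HasMFDerivAt (𝓡 n) (𝓡 m) f (j 0) (mfderiv (𝓡 n) (𝓡 m) f x) := by
    rw [hj0]; exact (hf.mdifferentiableAt one_ne_zero).hasMFDerivAt
  have hc' : ContMDiffAt (𝓡 m) (𝓡 m) 1 c' (f x) := contMDiffAt_extChartAt
  have hc'' : HasMFDerivAt (𝓡 m) (𝓡 m) c' (f x)
      (ContinuousLinearMap.id ℝ (EuclideanSpace ℝ (Fin m))) := by
    have h1 := (hc'.mdifferentiableAt one_ne_zero).hasMFDerivAt
    have h2 := mfderiv_extChartAt_self (I := 𝓡 m) (x := f x)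
    rwa [h2] at h1
  -- In charts, f restricted to the affine slice through x in the directions of A has differential
  -- the identity at 0. Its local inverse, followed by j, is the section.
  let ψ : EuclideanSpace ℝ (Fin m) → EuclideanSpace ℝ (Fin m) := fun w ↦ c' (f (j w))
  have hψ0 : ψ 0 = c' (f x) := by simp only [ψ, hj0]
  have hψ : ContDiffAt ℝ 1 ψ 0 := by
    rw [← contMDiffAt_iff_contDiffAt]
    refine ContMDiffAt.comp (I' := 𝓡 m) 0 (by rw [hj0]; exact hc')
      (ContMDiffAt.comp (I' := 𝓡 n) 0 (by rw [hj0]; exact hf) hj)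
  have hψ' : HasFDerivAt ψ ((ContinuousLinearEquiv.refl ℝ (EuclideanSpace ℝ (Fin m)) :
      EuclideanSpace ℝ (Fin m) →L[ℝ] EuclideanSpace ℝ (Fin m))) 0 := by
    have h1 : HasMFDerivAt (𝓡 m) (𝓡 m) c' (f (j 0))
      (ContinuousLinearMap.id ℝ (EuclideanSpace ℝ (Fin m))) := by rw [hj0]; exact hc''
    have h2 := (h1.comp 0 (hfj.comp 0 hj')).hasFDerivAt
    exact h2.congr_fderiv (ContinuousLinearMap.ext fun w ↦ hA w)
  let χ := hψ.localInverse hψ' one_ne_zero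
  have hχ0 : χ (c' (f x)) = 0 := by
    rw [← hψ0]; exact hψ.localInverse_apply_image hψ' one_ne_zero
  have hχ : ContMDiffAt (𝓡 m) (𝓡 m) 1 χ (c' (f x)) := by
    rw [← hψ0]; exact (hψ.to_localInverse hψ' one_ne_zero).contMDiffAt
  have hstrict := hψ.hasStrictFDerivAt' hψ' one_ne_zero
  have hχ' : HasMFDerivAt (𝓡 m) (𝓡 m) χ (c' (f x))
      (ContinuousLinearMap.id ℝ (EuclideanSpace ℝ (Fin m))) := by
    rw [← hψ0]
    exact hstrict.to_localInverse.hasFDerivAt.hasMFDerivAt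
  have hright : ∀ᶠ z in nhds (c' (f x)), ψ (χ z) = z := by
    rw [← hψ0]; exact hstrict.eventually_right_inverse
  have hs : ContMDiffAt (𝓡 m) (𝓡 n) 1 (fun y ↦ j (χ (c' y))) (f x) :=
    ContMDiffAt.comp (I' := 𝓡 m) (g := j) (f := fun y ↦ χ (c' y)) (f x) (by rw [hχ0]; exact hj)
      (ContMDiffAt.comp (I' := 𝓡 m) (f x) hχ hc')
  have hsx : j (χ (c' (f x))) = x := by rw [hχ0, hj0]
  refine ⟨fun y ↦ j (χ (c' y)), hs, hsx, ?_, ?_⟩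
  · have hfs : ContinuousAt (fun y ↦ f (j (χ (c' y)))) (f x) :=
      ContinuousAt.comp (g := f) (by rw [hsx]; exact hf.continuousAt) hs.continuousAt
    have hsrc : c'.source ∈ nhds (f (j (χ (c' (f x))))) := by
      rw [hsx]; exact extChartAt_source_mem_nhds (f x)
    filter_upwards [hfs hsrc, extChartAt_source_mem_nhds (I := 𝓡 m) (f x),
      hc'.continuousAt.eventually hright] with y hy hy' hr
    exact c'.injOn hy hy' hr
  · have hj'' : HasMFDerivAt (𝓡 m) (𝓡 n) j (χ (c' (f x))) A' := by rw [hχ0]; exact hj'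
    have := (hj''.comp (f x) (hχ'.comp (f x) hc'')).mfderiv
    exact this

variable {g : RiemMetric n X} {h : RiemMetric m Y} {f : X → Y}

instance finiteDimensional_tangentSpace (x : X) : FiniteDimensional ℝ (TangentSpace (𝓡 n) x) :=
  inferInstanceAs (FiniteDimensional ℝ (EuclideanSpace ℝ (Fin n)))

instance t2Space_tangentSpace (x : X) : T2Space (TangentSpace (𝓡 n) x) :=
  inferInstanceAs (T2Space (EuclideanSpace ℝ (Fin n)))

/-- The horizontal lift at a point. -/
theorem IsRiemannianSubmersion.exists_horizontal_lift (hf : IsRiemannianSubmersion g h f) (x : X) :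
    ∃ A : TangentSpace (𝓡 m) (f x) →L[ℝ] TangentSpace (𝓡 n) x,
      (∀ w, mfderiv (𝓡 n) (𝓡 m) f x (A w) = w) ∧
      (∀ w u, mfderiv (𝓡 n) (𝓡 m) f x u = 0 → g.inner x (A w) u = 0) ∧
      ∀ w, g.inner x (A w) (A w) = h.inner (f x) w w := by
  obtain ⟨A, hA, hA'⟩ := exists_orthogonal_rightInverse (g.inner x) (g.symm x) (g.pos x)
    (mfderiv (𝓡 n) (𝓡 m) f x) (hf.1.2 x)
  refine ⟨A, hA, hA', fun w ↦ ?_⟩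
  rw [← hf.2 x (A w) (A w) (hA' w) (hA' w), hA]

/-- Pythagoras: v is the sum of the horizontal lift of its image and an orthogonal vertical vector.
-/
theorem IsRiemannianSubmersion.inner_mfderiv_le (hf : IsRiemannianSubmersion g h f) (x : X)
    (v : TangentSpace (𝓡 n) x) :
    h.inner (f x) (mfderiv (𝓡 n) (𝓡 m) f x v) (mfderiv (𝓡 n) (𝓡 m) f x v) ≤ g.inner x v v := by
  obtain ⟨A, hA, hA', hAg⟩ := hf.exists_horizontal_lift x
  set w := mfderiv (𝓡 n) (𝓡 m) f x v with hw
  have hu : mfderiv (𝓡 n) (𝓡 m) f x (v - A w) = 0 := by rw [map_sub, hA, hw, sub_self]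
  have h1 := hA' w _ hu
  have h2 : g.inner x v v = g.inner x (A w) (A w) + g.inner x (v - A w) (v - A w) := by
    have h3 : g.inner x (v - A w) (A w) = 0 := by rw [g.symm, h1]
    have h4 : g.inner x v v = g.inner x (A w + (v - A w)) (A w + (v - A w)) := by
      rw [add_sub_cancel]
    rw [h4, map_add, map_add, add_apply, add_apply, h1, h3]
    ring
  rw [h2, hAg]
  linarith [riemMetric_nonneg g x (v - A w)]

/-- Riemannian submersions do not increase distances. -/
theorem IsRiemannianSubmersion.riemDist_le (hf : IsRiemannianSubmersion g h f) (x y : X) :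
    riemDist h (f x) (f y) ≤ riemDist g x y :=
  riemDist_map_le (hf.1.1.of_le (by simp)) hf.inner_mfderiv_le x y

/-- A curve in the base of a Riemannian submersion has local lifts whose length grows at most as
fast as that of the curve. -/
theorem IsRiemannianSubmersion.exists_local_lift (hf : IsRiemannianSubmersion g h f) {γ : ℝ → Y}
    {t : ℝ} (hγ : ContMDiffAt 𝓘(ℝ, ℝ) (𝓡 m) 1 γ t) {x : X} (hx : f x = γ t) :
    ∃ c : ℝ → X, ContMDiffAt 𝓘(ℝ, ℝ) (𝓡 n) 1 c t ∧ c t = x ∧ (∀ᶠ z in nhds t, f (c z) = γ z) ∧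
      ∀ r, riemSpeed h γ t < r →
        ∀ᶠ z in nhdsWithin t (Ioi t), riemDist g x (c z) ≤ ENNReal.ofReal (r * (z - t)) := by
  obtain ⟨A, hA, hA', hAg⟩ := hf.exists_horizontal_lift x
  obtain ⟨s, hs, hsx, hfs, hs'⟩ := exists_local_section ((hf.1.1.of_le (by simp)).contMDiffAt) A hA
  have hinner : ∀ y, y = f x → ∀ w : TangentSpace (𝓡 m) y,
      g.inner (s y) (mfderiv (𝓡 m) (𝓡 n) s y w) (mfderiv (𝓡 m) (𝓡 n) s y w) = h.inner y w w := by
    rintro _ rfl w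
    have hcongr : ∀ x', x' = x → ∀ v : EuclideanSpace ℝ (Fin n),
        g.inner x' v v = g.inner x v v := by rintro _ rfl _; rfl
    rw [hs', ← hAg]
    exact hcongr _ hsx (A w)
  rw [hx] at hs hsx hfs
  have hc : ContMDiffAt 𝓘(ℝ, ℝ) (𝓡 n) 1 (fun z ↦ s (γ z)) t := hs.comp t hγ
  refine ⟨fun z ↦ s (γ z), hc, hsx, hγ.continuousAt.eventually hfs, fun r hr ↦ ?_⟩
  -- The section is horizontal only at x, so the speeds agree only at time t; continuity of the
  -- speed then gives a bound by r just after t.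
  have hspeed : riemSpeed g (fun z ↦ s (γ z)) t = riemSpeed h γ t := by
    have h1 := mfderiv_comp_apply (I := 𝓘(ℝ, ℝ)) (I' := 𝓡 m) (I'' := 𝓡 n) t
      (hs.mdifferentiableAt one_ne_zero) (hγ.mdifferentiableAt one_ne_zero) (1 : ℝ)
    have h2 : (fun z ↦ s (γ z)) = s ∘ γ := rfl
    rw [riemSpeed, h2, h1, hinner _ hx.symm, riemSpeed]
  rw [← hspeed] at hr
  have hev : ∀ᶠ z in nhds t, riemSpeed g (fun z ↦ s (γ z)) z < r :=
    (continuousAt_riemSpeed g hc).eventually_lt_const hr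
  have : IsManifold (𝓡 n) 1 X := IsManifold.of_le (n := ∞) (by simp)
  obtain ⟨u, hu, hcu⟩ := contMDiffAt_iff_contMDiffOn_nhds (by simp) |>.1 hc
  obtain ⟨ε, hε, hball⟩ := Metric.mem_nhds_iff.1 (Filter.inter_mem hu hev)
  filter_upwards [Ioo_mem_nhdsGT (show t < t + ε by linarith)] with z hz
  have hIcc : Icc t z ⊆ u ∩ {z | riemSpeed g (fun z ↦ s (γ z)) z < r} := by
    refine Subset.trans (fun y hy ↦ ?_) hball
    rw [Metric.mem_ball, Real.dist_eq, abs_of_nonneg (by linarith [hy.1])]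
    linarith [hy.2, hz.2]
  have hle := riemDist_le_lintegral_riemSpeed g (hcu.mono (hIcc.trans inter_subset_left)) hz.1.le
  rw [hsx] at hle
  calc riemDist g x (s (γ z)) ≤ _ := hle
    _ ≤ ∫⁻ _ in Icc t z, ENNReal.ofReal r :=
        setLIntegral_mono measurable_const fun y hy ↦
          ENNReal.ofReal_le_ofReal (hIcc hy).2.le
    _ = ENNReal.ofReal (r * (z - t)) := by
        rw [setLIntegral_const, Real.volume_Icc, ENNReal.ofReal_mul]
        exact (Real.sqrt_nonneg _).trans hr.le

end Submersion

/-! ### Distances in the base of a homogeneous Riemannian submersion. -/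

section LeftInvariant

variable {n m : ℕ} {G M : Type*} [TopologicalSpace G] [ChartedSpace (EuclideanSpace ℝ (Fin n)) G]
  [Group G] [LieGroup (𝓡 n) ∞ G] [TopologicalSpace M] [ChartedSpace (EuclideanSpace ℝ (Fin m)) M]
  [IsManifold (𝓡 m) ∞ M] {g : RiemMetric n G} {h : RiemMetric m M}

theorem IsLeftInvariantMetric.riemDist_mul_left (hg : IsLeftInvariantMetric g) (σ x y : G) :
    riemDist g (σ * x) (σ * y) = riemDist g x y := by
  have hle : ∀ σ x y : G, riemDist g (σ * x) (σ * y) ≤ riemDist g x y := fun σ x y ↦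
    riemDist_map_le (F := fun z ↦ σ * z) ((contMDiff_mul_left (I := 𝓡 n) (n := ∞)).of_le (by simp))
      (fun x v ↦ (hg σ x v v).le) x y
  refine le_antisymm (hle σ x y) ?_
  simpa using hle σ⁻¹ (σ * x) (σ * y)

/-- The distance in the base of a homogeneous Riemannian submersion is realized upstairs. -/
theorem IsRiemannianSubmersion.exists_lift_of_riemDist_lt [ConnectedSpace G]
    (hg : IsLeftInvariantMetric g) {q : G → M} (hq : IsRiemannianSubmersion g h q)
    (hsurj : Function.Surjective q)
    (hfib : ∀ x y, q x = q y → ∃ κ, κ * y = x ∧ ∀ z, q (κ * z) = q z) {a : G} {y : M} {s : ℝ≥0∞}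
    (hs : riemDist h (q a) y < s) : ∃ b, q b = y ∧ riemDist g a b < s := by
  obtain ⟨γ, hγ0, hγ1, hγ, hl⟩ := exists_path_of_riemDist_lt h hs
  -- Instead of lifting γ horizontally as a whole, one follows the distance from a to the fibre over
  -- γ(t). Its growth rate is controlled by local lifts, and no differential equation has to be
  -- solved.
  let δ : M → ℝ≥0∞ := fun y ↦ ⨅ (b : G) (_ : q b = y), riemDist g a b
  have hδle : ∀ b, δ (q b) ≤ riemDist g a b := fun b ↦
    iInf₂_le (f := fun z (_ : q z = q b) ↦ riemDist g a z) b rfl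
  have hδtop : ∀ y, δ y ≠ ⊤ := by
    intro y
    obtain ⟨b, rfl⟩ := hsurj y
    exact ne_top_of_le_ne_top (riemDist_ne_top g a b) (hδle b)
  -- Fibres are equidistant: the isometry κ permutes points within each fibre, and can bring x to
  -- any point b of its own fibre.
  have hδ : ∀ x x', δ (q x') ≤ δ (q x) + riemDist g x x' := by
    intro x x'
    simp only [δ, ENNReal.iInf_add]
    refine le_iInf₂ fun b hb ↦ ?_
    obtain ⟨κ, rfl, hκ⟩ := hfib b x hb
    refine (iInf₂_le (κ * x') (hκ x')).trans ((riemDist_triangle g a (κ * x) _).trans ?_)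
    rw [hg.riemDist_mul_left]
  let f : ℝ → ℝ := fun t ↦ (δ (γ t)).toReal
  have hspeed : Continuous (riemSpeed h γ) :=
    continuous_iff_continuousAt.2 fun t ↦ continuousAt_riemSpeed h (hγ t)
  have hfcont : Continuous f := by
    refine continuous_iff_continuousAt.2 fun t ↦ ?_
    obtain ⟨x, hx⟩ := hsurj (γ t)
    obtain ⟨c, hc, hct, hcγ, -⟩ := hq.exists_local_lift (hγ t) hx
    have hlim : Filter.Tendsto (fun z ↦ riemDist g x (c z)) (nhds t) (nhds 0) := by
      have := (continuous_riemDist g x).continuousAt.comp hc.continuousAt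
      rwa [ContinuousAt, Function.comp_apply, hct, riemDist_self] at this
    refine (ENNReal.tendsto_toReal (hδtop _)).comp ?_
    rw [ENNReal.tendsto_nhds (hδtop _)]
    intro ε hε
    filter_upwards [hcγ, hlim.eventually (gt_mem_nhds hε)] with z hz hzε
    have h1 := hδ x (c z)
    have h2 := hδ (c z) x
    rw [hx, hz] at h1 h2
    rw [riemDist_comm] at h2
    exact ⟨tsub_le_iff_right.2 (h2.trans (by gcongr)), h1.trans (by gcongr)⟩
  have hslope : ∀ t ∈ Ico (0 : ℝ) 1, ∀ r, riemSpeed h γ t < r →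
      ∃ᶠ z in nhdsWithin t (Ioi t), slope f t z < r := by
    intro t _ r hr
    obtain ⟨x, hx⟩ := hsurj (γ t)
    obtain ⟨c, -, -, hcγ, hcle⟩ := hq.exists_local_lift (hγ t) hx
    obtain ⟨r', hr', hr'r⟩ := exists_between hr
    have hr'0 : 0 ≤ r' := (Real.sqrt_nonneg _).trans hr'.le
    refine Filter.Eventually.frequently ?_
    filter_upwards [hcle r' hr', nhdsWithin_le_nhds hcγ, self_mem_nhdsWithin] with z hz hzγ hzt
    have hzt' : 0 < z - t := sub_pos.2 hzt
    have h1 := hδ x (c z)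
    rw [hx, hzγ] at h1
    have h2 : f z ≤ f t + r' * (z - t) := by
      have h3 := ENNReal.toReal_mono (by simp [hδtop]) (h1.trans (add_le_add_right hz _))
      rwa [ENNReal.toReal_add (hδtop _) ENNReal.ofReal_ne_top,
        ENNReal.toReal_ofReal (by positivity)] at h3
    refine lt_of_le_of_lt ?_ hr'r
    rw [slope_def_field, div_le_iff₀ hzt']
    linarith
  have hf0 : f 0 = 0 := by
    have : δ (γ 0) = 0 := by
      rw [hγ0]
      exact le_antisymm ((hδle a).trans_eq (riemDist_self g a)) bot_le
    simp [f, this]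
  have hderiv : ∀ t, HasDerivAt (fun t ↦ ∫ u in (0 : ℝ)..t, riemSpeed h γ u) (riemSpeed h γ t) t :=
    fun t ↦ (hspeed.integral_hasStrictDerivAt 0 t).hasDerivAt
  -- A continuous function starting at 0, whose lower right slopes are bounded by the speed of γ,
  -- stays below the integral of that speed.
  have hf1 : f 1 ≤ ∫ u in (0 : ℝ)..1, riemSpeed h γ u := by
    refine image_le_of_liminf_slope_right_le_deriv_boundary hfcont.continuousOn (by simp [hf0])
      (fun t _ ↦ (hderiv t).continuousAt.continuousWithinAt)
      (fun t _ ↦ (hderiv t).hasDerivWithinAt) hslope (right_mem_Icc.2 zero_le_one)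
  have hδs : δ y < s := by
    refine lt_of_le_of_lt ?_ hl
    rw [← hγ1, ← ENNReal.ofReal_toReal (hδtop (γ 1))]
    refine (ENNReal.ofReal_le_ofReal hf1).trans ?_
    rw [intervalIntegral.integral_of_le zero_le_one, ← integral_Icc_eq_integral_Ioc,
      ofReal_integral_eq_lintegral_ofReal]
    · exact hspeed.continuousOn.integrableOn_Icc
    · exact Filter.Eventually.of_forall fun _ ↦ Real.sqrt_nonneg _
  simp only [δ, iInf_lt_iff] at hδs
  obtain ⟨b, hb, hbs⟩ := hδs
  exact ⟨b, hb, hbs⟩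

end LeftInvariant

/-! ### The Riemannian volume measure -/

section RiemVolume

variable {n : ℕ} {X : Type*} [TopologicalSpace X] [ChartedSpace (EuclideanSpace ℝ (Fin n)) X]
  [IsManifold (𝓡 n) ∞ X] (g : RiemMetric n X)

theorem det_gram_comp (B : EuclideanSpace ℝ (Fin n) →L[ℝ] EuclideanSpace ℝ (Fin n) →L[ℝ] ℝ)
    (J : EuclideanSpace ℝ (Fin n) →L[ℝ] EuclideanSpace ℝ (Fin n)) :
    (Matrix.of fun i j : Fin n ↦ B (J (EuclideanSpace.single i (1 : ℝ)))
      (J (EuclideanSpace.single j (1 : ℝ)))).det = J.det ^ 2 *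
    (Matrix.of fun i j : Fin n ↦ B (EuclideanSpace.single i (1 : ℝ))
      (EuclideanSpace.single j (1 : ℝ))).det := by
  let b : LinearMap.BilinForm ℝ (EuclideanSpace ℝ (Fin n)) := LinearMap.mk₂ ℝ (fun v w ↦ B v w)
    (by simp) (by simp) (by simp) (by simp)
  let e := (EuclideanSpace.basisFun (Fin n) ℝ).toBasis
  have h1 : (Matrix.of fun i j : Fin n ↦ B (J (EuclideanSpace.single i (1 : ℝ)))
      (J (EuclideanSpace.single j (1 : ℝ)))) =
      LinearMap.BilinForm.toMatrix e (b.comp J.toLinearMap J.toLinearMap) := by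
    ext i j
    simp [LinearMap.BilinForm.toMatrix_apply, e, b]
  have h2 : (Matrix.of fun i j : Fin n ↦ B (EuclideanSpace.single i (1 : ℝ))
      (EuclideanSpace.single j (1 : ℝ))) = LinearMap.BilinForm.toMatrix e b := by
    ext i j
    simp [LinearMap.BilinForm.toMatrix_apply, e, b]
  rw [h1, h2, LinearMap.BilinForm.toMatrix_comp e e, Matrix.det_mul, Matrix.det_mul,
    Matrix.det_transpose, LinearMap.det_toMatrix]
  change _ = (LinearMap.det J.toLinearMap) ^ 2 * _
  ring

theorem det_gram_pos (B : EuclideanSpace ℝ (Fin n) →L[ℝ] EuclideanSpace ℝ (Fin n) →L[ℝ] ℝ)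
    (hsymm : ∀ v w, B v w = B w v) (hpos : ∀ v, v ≠ 0 → 0 < B v v) :
    0 < (Matrix.of fun i j : Fin n ↦ B (EuclideanSpace.single i (1 : ℝ))
      (EuclideanSpace.single j (1 : ℝ))).det := by
  refine Matrix.PosDef.det_pos (Matrix.PosDef.of_dotProduct_mulVec_pos ?_ ?_)
  · ext i j
    simp [hsymm (EuclideanSpace.single j (1 : ℝ))]
  · intro x hx
    have hx' : (WithLp.toLp 2 x : EuclideanSpace ℝ (Fin n)) ≠ 0 := by
      simpa using hx
    have hsum : (WithLp.toLp 2 x : EuclideanSpace ℝ (Fin n)) =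
        ∑ i, x i • EuclideanSpace.single i (1 : ℝ) := by
      ext j
      simp [Finset.sum_apply, Pi.single_apply]
    have h := hpos _ hx'
    rw [hsum] at h
    simp only [map_sum, map_smul, sum_apply, smul_apply,
      smul_eq_mul] at h
    simp only [Finset.mul_sum] at h
    rw [Finset.sum_comm] at h
    simp only [dotProduct, Matrix.mulVec, Finset.mul_sum]
    refine h.trans_eq (Finset.sum_congr rfl fun i _ ↦ Finset.sum_congr rfl fun j _ ↦ ?_)
    simp only [Pi.star_apply, star_trivial, Matrix.of_apply]
    ring

theorem mdifferentiableAt_extChartAt_symm (x : X) {z : EuclideanSpace ℝ (Fin n)}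
    (hz : z ∈ (extChartAt (𝓡 n) x).target) :
    MDifferentiableAt (𝓡 n) (𝓡 n) (extChartAt (𝓡 n) x).symm z := by
  exact ((contMDiffOn_extChartAt_symm (I := 𝓡 n) (n := ∞) x).contMDiffAt
    ((isOpen_extChartAt_target x).mem_nhds hz)).mdifferentiableAt (by simp)

/-- The pull-back of the metric under the inverse of a chart. -/
noncomputable def chartForm (x : X) (z : EuclideanSpace ℝ (Fin n)) :
    EuclideanSpace ℝ (Fin n) →L[ℝ] EuclideanSpace ℝ (Fin n) →L[ℝ] ℝ :=
  let L : EuclideanSpace ℝ (Fin n) →L[ℝ] EuclideanSpace ℝ (Fin n) :=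
    mfderiv (𝓡 n) (𝓡 n) (extChartAt (𝓡 n) x).symm z
  let B : EuclideanSpace ℝ (Fin n) →L[ℝ] EuclideanSpace ℝ (Fin n) →L[ℝ] ℝ :=
    g.inner ((extChartAt (𝓡 n) x).symm z)
  B.bilinearComp L L

theorem chartForm_apply (x : X) (z v w : EuclideanSpace ℝ (Fin n)) :
    chartForm g x z v w = g.inner ((extChartAt (𝓡 n) x).symm z)
      (mfderiv (𝓡 n) (𝓡 n) (extChartAt (𝓡 n) x).symm z v)
      (mfderiv (𝓡 n) (𝓡 n) (extChartAt (𝓡 n) x).symm z w) := rfl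

theorem chartGram_eq (x : X) (z : EuclideanSpace ℝ (Fin n)) :
    chartGram g x z = Matrix.of fun i j : Fin n ↦ chartForm g x z (EuclideanSpace.single i (1 : ℝ))
      (EuclideanSpace.single j (1 : ℝ)) := rfl

theorem det_chartGram_pos (x : X) {z : EuclideanSpace ℝ (Fin n)}
    (hz : z ∈ (extChartAt (𝓡 n) x).target) : 0 < (chartGram g x z).det := by
  rw [chartGram_eq]
  refine det_gram_pos _ (fun v w ↦ ?_) fun v hv ↦ ?_
  · rw [chartForm_apply, chartForm_apply, g.symm]
  rw [chartForm_apply]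
  refine g.pos _ _ ?_
  have hinv := isInvertible_mfderivWithin_extChartAt_symm (I := 𝓡 n) hz
  rw [ModelWithCorners.range_eq_univ, mfderivWithin_univ] at hinv
  obtain ⟨L, hL⟩ := hinv
  intro h0
  exact hv (L.injective (((DFunLike.congr_fun hL v).trans h0).trans (map_zero L).symm))

theorem continuousOn_chartDensity (x : X) :
    ContinuousOn (fun z ↦ √(chartGram g x z).det) (extChartAt (𝓡 n) x).target := by
  refine ContinuousOn.sqrt ?_
  rw [continuousOn_iff_continuous_domRestrict]
  refine Continuous.matrix_det (continuous_matrix fun i j ↦ ?_)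
  have := continuousOn_inner_mfderiv g (isOpen_extChartAt_target (I := 𝓡 n) x)
    ((contMDiffOn_extChartAt_symm (I := 𝓡 n) (n := ∞) x).of_le (by simp))
    (EuclideanSpace.single i (1 : ℝ)) (EuclideanSpace.single j (1 : ℝ))
  exact continuousOn_iff_continuous_domRestrict.1 this

variable [MeasurableSpace X] [BorelSpace X]

theorem MeasurableSet.inter_preimage_of_continuousOn {α β : Type*} [TopologicalSpace α]
    [MeasurableSpace α] [OpensMeasurableSpace α] [TopologicalSpace β] [MeasurableSpace β]
    [BorelSpace β] {t : Set α} (ht : MeasurableSet t) {f : α → β} (hf : ContinuousOn f t)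
    {s : Set β} (hs : MeasurableSet s) : MeasurableSet (t ∩ f ⁻¹' s) := by
  have := ht.subtype_image ((continuousOn_iff_continuous_domRestrict.1 hf).measurable hs)
  convert this using 1
  ext a
  simp [and_comm]

theorem chartVolume_apply (x : X) {s : Set X} (hs : MeasurableSet s) :
    chartVolume g x s = ∫⁻ z in (extChartAt (𝓡 n) x).target ∩ (extChartAt (𝓡 n) x).symm ⁻¹' s,
      ENNReal.ofReal √(chartGram g x z).det := by
  have htarget := (isOpen_extChartAt_target (I := 𝓡 n) x).measurableSet
  have hcont := continuousOn_extChartAt_symm (I := 𝓡 n) x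
  have hm : AEMeasurable (extChartAt (𝓡 n) x).symm
      (((volume : Measure (EuclideanSpace ℝ (Fin n))).restrict (extChartAt (𝓡 n) x).target)) :=
    hcont.aemeasurable htarget
  have hpre : MeasurableSet ((extChartAt (𝓡 n) x).target ∩ (extChartAt (𝓡 n) x).symm ⁻¹' s) :=
    htarget.inter_preimage_of_continuousOn hcont hs
  rw [chartVolume, Measure.map_apply_of_aemeasurable
    (hm.mono_ac (withDensity_absolutelyContinuous _ _)) hs]
  rw [withDensity_apply', Measure.restrict_restrict' htarget, inter_comm]

/-- The volume densities in two charts correspond to each other under an isometry. -/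
theorem chartVolume_preimage_eq {F : X ≃ₜ X} (hF : ContMDiff (𝓡 n) (𝓡 n) 1 F)
    (hiso : ∀ x (v w : TangentSpace (𝓡 n) x), g.inner (F x) (mfderiv (𝓡 n) (𝓡 n) F x v)
      (mfderiv (𝓡 n) (𝓡 n) F x w) = g.inner x v w) (x y : X) {s : Set X} (hs : MeasurableSet s)
    (hsy : s ⊆ (extChartAt (𝓡 n) y).source) (hsx : F ⁻¹' s ⊆ (extChartAt (𝓡 n) x).source) :
    chartVolume g x (F ⁻¹' s) = chartVolume g y s := by
  have : IsManifold (𝓡 n) 1 X := IsManifold.of_le (n := ∞) (by simp)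
  have hs' : MeasurableSet (F ⁻¹' s) := F.continuous.measurable hs
  rw [chartVolume_apply g x hs', chartVolume_apply g y hs]
  set c := extChartAt (𝓡 n) x
  set c' := extChartAt (𝓡 n) y
  set D := c.target ∩ c.symm ⁻¹' (F ⁻¹' s)
  have hD : MeasurableSet D := (isOpen_extChartAt_target (I := 𝓡 n) x).measurableSet
    |>.inter_preimage_of_continuousOn (continuousOn_extChartAt_symm (I := 𝓡 n) x) hs'
  let Φ : EuclideanSpace ℝ (Fin n) → EuclideanSpace ℝ (Fin n) := fun z ↦ c' (F (c.symm z))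
  have hinj : InjOn Φ D := by
    intro z hz w hw hzw
    exact c.symm.injOn hz.1 hw.1 (F.injective (c'.injOn (hsy hz.2) (hsy hw.2) hzw))
  have himage : Φ '' D = c'.target ∩ c'.symm ⁻¹' s := by
    ext w
    constructor
    · rintro ⟨z, hz, rfl⟩
      refine ⟨c'.map_source (hsy hz.2), ?_⟩
      simp only [Φ, mem_preimage, c'.left_inv (hsy hz.2)]
      exact hz.2
    · rintro ⟨hw, hws⟩
      have hmem : F.symm (c'.symm w) ∈ F ⁻¹' s := by simpa using hws
      refine ⟨c (F.symm (c'.symm w)), ⟨c.map_source (hsx hmem), ?_⟩, ?_⟩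
      · simpa [c.left_inv (hsx hmem)] using hws
      · simp [Φ, c.left_inv (hsx hmem), c'.right_inv hw]
  have hcs : ∀ z ∈ D, MDifferentiableAt (𝓡 n) (𝓡 n) c.symm z := fun z hz ↦
    mdifferentiableAt_extChartAt_symm x hz.1
  have hcs' : ∀ z ∈ D, MDifferentiableAt (𝓡 n) (𝓡 n) c'.symm (Φ z) := fun z hz ↦
    mdifferentiableAt_extChartAt_symm y (c'.map_source (hsy hz.2))
  have hc' : ∀ z ∈ D, MDifferentiableAt (𝓡 n) (𝓡 n) c' (F (c.symm z)) := fun z hz ↦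
    mdifferentiableAt_extChartAt (by simpa [c'] using hsy hz.2)
  have hFm : ∀ p, MDifferentiableAt (𝓡 n) (𝓡 n) F p := fun p ↦
    (hF p).mdifferentiableAt one_ne_zero
  have hΦm : ∀ z ∈ D, MDifferentiableAt (𝓡 n) (𝓡 n) Φ z := fun z hz ↦
    (hc' z hz).comp z ((hFm _).comp z (hcs z hz))
  have hΦ : ∀ z ∈ D, HasFDerivAt Φ (fderiv ℝ Φ z) z := fun z hz ↦
    (hΦm z hz).differentiableAt.hasFDerivAt
  -- Differentiate the identity c'⁻¹ ∘ Φ = F ∘ c⁻¹, valid near z. The Gram matrices then differ by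
  -- the Jacobian of Φ, whose determinant is the factor in the change of variables.
  have hchain : ∀ z ∈ D, ∀ v : EuclideanSpace ℝ (Fin n),
      mfderiv (𝓡 n) (𝓡 n) F (c.symm z) (mfderiv (𝓡 n) (𝓡 n) c.symm z v) =
      mfderiv (𝓡 n) (𝓡 n) c'.symm (Φ z) (fderiv ℝ Φ z v) := by
    intro z hz v
    have h1 := mfderiv_comp_apply (I := 𝓡 n) (I' := 𝓡 n) (I'' := 𝓡 n) z (hFm _) (hcs z hz) v
    have h2 := mfderiv_comp_apply (I := 𝓡 n) (I' := 𝓡 n) (I'' := 𝓡 n) z (hcs' z hz) (hΦm z hz) v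
    have h3 : (c'.symm ∘ Φ) =ᶠ[nhds z] (F ∘ c.symm) := by
      have hopen : IsOpen (c.target ∩ (F ∘ c.symm) ⁻¹' c'.source) :=
        (F.continuous.comp_continuousOn (continuousOn_extChartAt_symm (I := 𝓡 n) x))
          |>.isOpen_inter_preimage (isOpen_extChartAt_target x) (isOpen_extChartAt_source y)
      filter_upwards [hopen.mem_nhds ⟨hz.1, hsy hz.2⟩] with w hw
      exact c'.left_inv hw.2
    rw [mfderiv_eq_fderiv] at h2
    exact h1.symm.trans
      ((DFunLike.congr_fun (h3.mfderiv_eq (I := 𝓡 n) (I' := 𝓡 n)) v).symm.trans h2)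
  have hdet : ∀ z ∈ D, (chartGram g x z).det =
      (fderiv ℝ Φ z).det ^ 2 * (chartGram g y (Φ z)).det := by
    intro z hz
    rw [chartGram_eq g y, ← det_gram_comp]
    congr 1
    ext i j
    have hcongr : ∀ p q : X, p = q → ∀ v w : EuclideanSpace ℝ (Fin n),
        g.inner p v w = g.inner q v w := by rintro _ _ rfl _ _; rfl
    have hp : F (c.symm z) = c'.symm (Φ z) := (c'.left_inv (hsy hz.2)).symm
    change g.inner (c.symm z) _ _ = g.inner (c'.symm (Φ z)) _ _
    rw [← hiso, hchain z hz, hchain z hz]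
    exact hcongr _ _ hp _ _
  rw [← himage, lintegral_image_eq_lintegral_abs_det_fderiv_mul volume hD
    (fun z hz ↦ (hΦ z hz).hasFDerivWithinAt) hinj]
  refine setLIntegral_congr_fun hD fun z hz ↦ ?_
  rw [hdet z hz, Real.sqrt_mul (sq_nonneg _), Real.sqrt_sq_eq_abs,
    ENNReal.ofReal_mul (abs_nonneg _)]

theorem chartVolume_eq_zero (x : X) {s : Set X} (hs : MeasurableSet s)
    (hsx : Disjoint s (extChartAt (𝓡 n) x).source) : chartVolume g x s = 0 := by
  have : (extChartAt (𝓡 n) x).target ∩ (extChartAt (𝓡 n) x).symm ⁻¹' s = ∅ := by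
    ext z
    simp only [mem_inter_iff, mem_preimage, mem_empty_iff_false, iff_false, not_and]
    exact fun hz hzs ↦ disjoint_left.1 hsx hzs ((extChartAt (𝓡 n) x).map_target hz)
  rw [chartVolume_apply g x hs, this, Measure.restrict_empty, lintegral_zero_measure]

theorem chartVolume_eq (x y : X) {s : Set X} (hs : MeasurableSet s)
    (hsx : s ⊆ (extChartAt (𝓡 n) x).source) (hsy : s ⊆ (extChartAt (𝓡 n) y).source) :
    chartVolume g x s = chartVolume g y s :=
  chartVolume_preimage_eq g (F := Homeomorph.refl X) contMDiff_id
    (fun x v w ↦ by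
      have : mfderiv (𝓡 n) (𝓡 n) (Homeomorph.refl X) x = ContinuousLinearMap.id ℝ _ := mfderiv_id
      rw [this]; rfl) x y hs hsy hsx

/-- The Riemannian volume is given by the volume density in each chart. -/
theorem riemVolume_eq_chartVolume (x : X) {s : Set X} (hs : MeasurableSet s)
    (hsx : s ⊆ (extChartAt (𝓡 n) x).source) : riemVolume g s = chartVolume g x s := by
  have hle : ∀ y, chartVolume g y ≤ riemVolume g := fun y ↦ le_iSup (chartVolume g) y
  refine le_antisymm ?_ (hle x s)
  have hsrc : ∀ y : X, MeasurableSet (extChartAt (𝓡 n) y).source := fun y ↦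
    (isOpen_extChartAt_source y).measurableSet
  -- The supremum is the least upper bound, so it suffices that this measure dominates each
  -- `chartVolume g y`: inside the chart at x by agreement on overlaps, outside it trivially.
  have hbound : riemVolume g ≤
      chartVolume g x + (riemVolume g).restrict (extChartAt (𝓡 n) x).sourceᶜ := by
    refine iSup_le fun y ↦ Measure.le_iff.2 fun t ht ↦ ?_
    rw [Measure.add_apply, Measure.restrict_apply ht,
      ← measure_inter_add_sdiff t (hsrc x)]
    refine add_le_add ?_ (hle y _)
    rw [← measure_inter_add_sdiff _ (hsrc y), chartVolume_eq_zero g y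
      ((ht.inter (hsrc x)).diff (hsrc y)) disjoint_sdiff_left, add_zero,
      chartVolume_eq g y x ((ht.inter (hsrc x)).inter (hsrc y)) inter_subset_right
        (inter_subset_left.trans inter_subset_right)]
    exact measure_mono (inter_subset_left.trans inter_subset_left)
  refine (hbound s).trans ?_
  have : s ∩ (extChartAt (𝓡 n) x).sourceᶜ = ∅ := by
    rw [← sdiff_eq, sdiff_eq_empty]; exact hsx
  rw [Measure.add_apply, Measure.restrict_apply hs, this, measure_empty, add_zero]

/-- Isometries preserve the Riemannian volume. -/
theorem map_riemVolume [SecondCountableTopology X] {F : X ≃ₜ X}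
    (hF : ContMDiff (𝓡 n) (𝓡 n) 1 F)
    (hiso : ∀ x (v w : TangentSpace (𝓡 n) x), g.inner (F x) (mfderiv (𝓡 n) (𝓡 n) F x v)
      (mfderiv (𝓡 n) (𝓡 n) F x w) = g.inner x v w) :
    (riemVolume g).map F = riemVolume g := by
  obtain ⟨S, hS, hcover⟩ := TopologicalSpace.countable_cover_nhds
    fun x : X ↦ extChartAt_source_mem_nhds (I := 𝓡 n) x
  have : Countable S := hS.to_subtype
  have hcov : ∀ x, ∃ y ∈ S, x ∈ (extChartAt (𝓡 n) y).source := fun x ↦ by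
    have := hcover.ge (mem_univ x)
    simpa using this
  -- Countably many pieces, each inside one chart domain and with preimage under F inside another,
  -- so that the comparison of two charts applies.
  let W : S × S → Set X := fun q ↦
    (extChartAt (𝓡 n) q.2.1).source ∩ F.symm ⁻¹' (extChartAt (𝓡 n) q.1.1).source
  have hW : ∀ q, MeasurableSet (W q) := fun q ↦ ((isOpen_extChartAt_source _).inter
    ((isOpen_extChartAt_source _).preimage F.symm.continuous)).measurableSet
  have hWu : ⋃ q, W q = univ := by
    refine eq_univ_of_forall fun x ↦ ?_
    obtain ⟨y, hy, hxy⟩ := hcov x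
    obtain ⟨z, hz, hxz⟩ := hcov (F.symm x)
    exact mem_iUnion.2 ⟨(⟨z, hz⟩, ⟨y, hy⟩), hxy, hxz⟩
  refine Measure.ext_of_iUnion_eq_univ hWu fun q ↦ ?_
  ext s hs
  have hm : MeasurableSet (s ∩ W q) := hs.inter (hW q)
  have hsub : F ⁻¹' (s ∩ W q) ⊆ (extChartAt (𝓡 n) q.1.1).source := by
    rintro x ⟨-, -, hx⟩
    simpa using hx
  have hsub' : s ∩ W q ⊆ (extChartAt (𝓡 n) q.2.1).source := fun x hx ↦ hx.2.1
  rw [Measure.restrict_apply hs, Measure.restrict_apply hs,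
    Measure.map_apply F.continuous.measurable hm,
    riemVolume_eq_chartVolume g q.1.1 (F.continuous.measurable hm) hsub,
    riemVolume_eq_chartVolume g q.2.1 hm hsub',
    chartVolume_preimage_eq g hF hiso _ _ hm hsub' hsub]

/-- Every point has a compact neighbourhood of finite positive volume. -/
theorem exists_isCompact_riemVolume [T2Space X] (x : X) : ∃ K : Set X, IsCompact K ∧ K ∈ nhds x ∧
    riemVolume g K ≠ 0 ∧ riemVolume g K ≠ ⊤ := by
  set c := extChartAt (𝓡 n) x with hc
  obtain ⟨ε, hε, hball⟩ := Metric.nhds_basis_closedBall.mem_iff.1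
    (extChartAt_target_mem_nhds (I := 𝓡 n) x)
  have hcomp : IsCompact (Metric.closedBall (c x) ε) := isCompact_closedBall _ _
  have hcont : ContinuousOn c.symm (Metric.closedBall (c x) ε) :=
    (continuousOn_extChartAt_symm (I := 𝓡 n) x).mono hball
  have hK : IsCompact (c.symm '' Metric.closedBall (c x) ε) := hcomp.image_of_continuousOn hcont
  have hKs : c.symm '' Metric.closedBall (c x) ε ⊆ c.source := by
    rintro _ ⟨z, hz, rfl⟩
    exact c.map_target (hball hz)
  have hpre : c.target ∩ c.symm ⁻¹' (c.symm '' Metric.closedBall (c x) ε) =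
      Metric.closedBall (c x) ε := by
    ext z
    constructor
    · rintro ⟨hz, w, hw, hwz⟩
      rwa [← c.symm.injOn (hball hw) hz hwz]
    · exact fun hz ↦ ⟨hball hz, mem_image_of_mem _ hz⟩
  have hvol : riemVolume g (c.symm '' Metric.closedBall (c x) ε) =
      ∫⁻ z in Metric.closedBall (c x) ε, ENNReal.ofReal √(chartGram g x z).det := by
    rw [riemVolume_eq_chartVolume g x hK.measurableSet hKs, chartVolume_apply g x hK.measurableSet,
      ← hc, hpre]
  have hdens := (continuousOn_chartDensity g x).mono hball
  refine ⟨_, hK, ?_, ?_, ?_⟩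
  · have h1 : c ⁻¹' Metric.closedBall (c x) ε ∈ nhds x :=
      (continuousAt_extChartAt (I := 𝓡 n) x) (Metric.closedBall_mem_nhds _ hε)
    filter_upwards [h1, extChartAt_source_mem_nhds (I := 𝓡 n) x] with y hy hys
    exact ⟨c y, hy, c.left_inv hys⟩
  · rw [hvol]
    have hm : AEMeasurable (fun z ↦ ENNReal.ofReal √(chartGram g x z).det)
        ((volume : Measure (EuclideanSpace ℝ (Fin n))).restrict (Metric.closedBall (c x) ε)) :=
      (hdens.aemeasurable Metric.isClosed_closedBall.measurableSet).ennreal_ofReal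
    intro h0
    rw [lintegral_eq_zero_iff' hm] at h0
    have h1 : ∀ᵐ z ∂((volume : Measure (EuclideanSpace ℝ (Fin n))).restrict
        (Metric.closedBall (c x) ε)), False := by
      filter_upwards [h0, ae_restrict_mem Metric.isClosed_closedBall.measurableSet] with z hz hzb
      have := Real.sqrt_pos.2 (det_chartGram_pos g x (hball hzb))
      simp only [Pi.zero_apply, ENNReal.ofReal_eq_zero] at hz
      linarith
    rw [Filter.eventually_false_iff_eq_bot, ae_eq_bot, Measure.restrict_eq_zero] at h1
    exact (Metric.measure_closedBall_pos volume (c x) hε).ne' h1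
  · rw [hvol]
    obtain ⟨C, hC⟩ := hcomp.bddAbove_image hdens
    refine ne_top_of_le_ne_top ?_ (setLIntegral_mono (g := fun _ ↦ ENNReal.ofReal C)
      measurable_const fun z hz ↦ ENNReal.ofReal_le_ofReal (hC (mem_image_of_mem _ hz)))
    rw [setLIntegral_const]
    exact ENNReal.mul_ne_top ENNReal.ofReal_ne_top hcomp.measure_lt_top.ne

end RiemVolume

/-! ### Riemannian volume as a Haar measure. -/

section Haar

variable {n : ℕ} {G : Type*} [TopologicalSpace G] [T2Space G] [SecondCountableTopology G]
  [ChartedSpace (EuclideanSpace ℝ (Fin n)) G] [Group G] [LieGroup (𝓡 n) ∞ G] [MeasurableSpace G]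
  [BorelSpace G] {g : RiemMetric n G}

/-- The Riemannian volume of a left-invariant metric is a Haar measure. -/
theorem IsLeftInvariantMetric.isHaarMeasure_riemVolume (hg : IsLeftInvariantMetric g) :
    (riemVolume g).IsHaarMeasure := by
  have : IsTopologicalGroup G := topologicalGroup_of_lieGroup (𝓡 n) ∞
  have : (riemVolume g).IsMulLeftInvariant := ⟨fun σ ↦
    map_riemVolume g (F := Homeomorph.mulLeft σ)
      ((contMDiff_mul_left (I := 𝓡 n) (n := ∞) (a := σ)).of_le (by simp)) (hg σ)⟩
  obtain ⟨K, hK, hKn, h0, htop⟩ := exists_isCompact_riemVolume g (1 : G)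
  exact Measure.isHaarMeasure_of_isCompact_nonempty_interior _ K hK
    ⟨1, mem_interior_iff_mem_nhds.2 hKn⟩ h0 htop

/-- The doubling constant does not depend on the choice of the Haar measure. -/
theorem IsLeftInvariantMetric.doublingConst_riemVolume (hg : IsLeftInvariantMetric g)
    (μ : Measure G) [μ.IsHaarMeasure] (d : G → G → ℝ≥0∞) :
    doublingConst d (riemVolume g) = doublingConst d μ := by
  have : IsTopologicalGroup G := topologicalGroup_of_lieGroup (𝓡 n) ∞
  have : LocallyCompactSpace G := Manifold.locallyCompact_of_finiteDimensional (𝓡 n)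
  have := hg.isHaarMeasure_riemVolume
  have hsmul := Measure.isMulLeftInvariant_eq_smul (riemVolume g) μ
  have h0 := Measure.haarScalarFactor_pos_of_isHaarMeasure (riemVolume g) μ
  have h0' : ((Measure.haarScalarFactor (riemVolume g) μ : ℝ≥0) : ℝ≥0∞) ≠ 0 := by
    exact_mod_cast h0.ne'
  simp only [doublingConst]
  refine iSup_congr fun x ↦ iSup_congr fun r ↦ iSup_congr fun hr ↦ ?_
  rw [hsmul, Measure.smul_apply, Measure.smul_apply, ENNReal.smul_def, ENNReal.smul_def,
    smul_eq_mul, smul_eq_mul, ENNReal.mul_div_mul_left _ _ h0' ENNReal.coe_ne_top]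

end Haar

/-! ### Left-invariant metrics -/

/-- The minimum of v ↦ B v v on the compact unit sphere is positive, so B v v dominates a multiple
of ‖v‖². -/
theorem isVonNBounded_of_posDef {E : Type*} [NormedAddCommGroup E] [NormedSpace ℝ E]
    [FiniteDimensional ℝ E] (B : E →L[ℝ] E →L[ℝ] ℝ) (hpos : ∀ v, v ≠ 0 → 0 < B v v) :
    Bornology.IsVonNBounded ℝ {v | B v v < 1} := by
  rw [NormedSpace.isVonNBounded_iff]
  rcases subsingleton_or_nontrivial E with hE | hE
  · exact (Set.toFinite _).isBounded
  have hcont : Continuous fun v ↦ B v v := by fun_prop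
  obtain ⟨u, hu, hmin⟩ := (isCompact_sphere (0 : E) 1).exists_isMinOn
    (NormedSpace.sphere_nonempty.2 zero_le_one) hcont.continuousOn
  have hu1 : ‖u‖ = 1 := by simpa using hu
  have hc : 0 < B u u := hpos u (by rintro rfl; simp at hu1)
  have hle : ∀ v, B u u * ‖v‖ ^ 2 ≤ B v v := by
    intro v
    rcases eq_or_ne v 0 with rfl | hv
    · simp
    have hv' : 0 < ‖v‖ := norm_pos_iff.2 hv
    have h1 : B u u ≤ B (‖v‖⁻¹ • v) (‖v‖⁻¹ • v) :=
      hmin (by simp [norm_smul, hv'.ne'])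
    simp only [map_smul, smul_apply, smul_eq_mul] at h1
    calc B u u * ‖v‖ ^ 2 ≤ ‖v‖⁻¹ * (‖v‖⁻¹ * B v v) * ‖v‖ ^ 2 := by gcongr
      _ = B v v := by field_simp
  refine isBounded_iff_forall_norm_le.2 ⟨√(1 / B u u), fun v hv ↦ ?_⟩
  refine Real.le_sqrt_of_sq_le ?_
  rw [le_div_iff₀ hc, mul_comm]
  exact (hle v).trans (le_of_lt hv)

theorem contDiff_bilinearComp_self {E : Type*} [NormedAddCommGroup E] [NormedSpace ℝ E]
    [FiniteDimensional ℝ E] (B : E →L[ℝ] E →L[ℝ] ℝ) :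
    ContDiff ℝ ∞ fun L : E →L[ℝ] E ↦ B.bilinearComp L L := by
  refine contDiff_clm_apply_iff.2 fun v ↦ contDiff_clm_apply_iff.2 fun w ↦ ?_
  simp only [ContinuousLinearMap.bilinearComp_apply]
  fun_prop

section LeftInvariantMetric

variable {n : ℕ} {G : Type*} [TopologicalSpace G] [ChartedSpace (EuclideanSpace ℝ (Fin n)) G]
  [Group G] [LieGroup (𝓡 n) ∞ G]

variable (n) in
/-- The differential at `x` of the left translation by `x⁻¹`. -/
noncomputable def translationToOne (x : G) :
    EuclideanSpace ℝ (Fin n) →L[ℝ] EuclideanSpace ℝ (Fin n) :=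
  mfderiv (𝓡 n) (𝓡 n) (fun y : G ↦ x⁻¹ * y) x

theorem mdifferentiableAt_leftTranslation (σ x : G) :
    MDifferentiableAt (𝓡 n) (𝓡 n) (fun y : G ↦ σ * y) x :=
  (contMDiff_mul_left (I := 𝓡 n) (n := ∞) (a := σ) x).mdifferentiableAt (by simp)

theorem translationToOne_mul (σ x : G) (v : TangentSpace (𝓡 n) x) :
    translationToOne n (σ * x) (mfderiv (𝓡 n) (𝓡 n) (fun y : G ↦ σ * y) x v) =
      translationToOne n x v := by
  have h := mfderiv_comp_apply (I := 𝓡 n) (I' := 𝓡 n) (I'' := 𝓡 n) x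
    (mdifferentiableAt_leftTranslation (n := n) (σ * x)⁻¹ (σ * x)) (mdifferentiableAt_leftTranslation σ x) v
  have h' : (fun y : G ↦ (σ * x)⁻¹ * y) ∘ (fun y : G ↦ σ * y) = fun y ↦ x⁻¹ * y := by
    ext y; simp [mul_assoc]
  rw [h'] at h
  exact h.symm

theorem translationToOne_injective (x : G) : Function.Injective (translationToOne n x) := by
  have h' : (fun y : G ↦ x * y) ∘ (fun y : G ↦ x⁻¹ * y) = id := by
    ext y; simp
  refine Function.LeftInverse.injective (g := fun w : EuclideanSpace ℝ (Fin n) ↦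
    (mfderiv (𝓡 n) (𝓡 n) (fun y : G ↦ x * y) (x⁻¹ * x) w : EuclideanSpace ℝ (Fin n))) fun v ↦ ?_
  have h := mfderiv_comp_apply (I := 𝓡 n) (I' := 𝓡 n) (I'' := 𝓡 n) x
    (mdifferentiableAt_leftTranslation (n := n) x (x⁻¹ * x)) (mdifferentiableAt_leftTranslation x⁻¹ x) v
  rw [h', mfderiv_id] at h
  exact h.symm

theorem translationToOne_surjective (x : G) : Function.Surjective (translationToOne n x) :=
  LinearMap.injective_iff_surjective.1 (translationToOne_injective x)

/-- The differential in y of the smooth map (x, y) ↦ x⁻¹y, taken at y = x, depends smoothly on x,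
and the pulled-back form is a polynomial in that differential. -/
theorem contMDiff_leftInvariantForm
    (B : EuclideanSpace ℝ (Fin n) →L[ℝ] EuclideanSpace ℝ (Fin n) →L[ℝ] ℝ) :
    ContMDiff (𝓡 n) ((𝓡 n).prod 𝓘(ℝ, EuclideanSpace ℝ (Fin n) →L[ℝ]
      EuclideanSpace ℝ (Fin n) →L[ℝ] ℝ)) ∞ (fun x : G ↦ TotalSpace.mk'
        (EuclideanSpace ℝ (Fin n) →L[ℝ] EuclideanSpace ℝ (Fin n) →L[ℝ] ℝ)
        (E := fun x : G ↦ (TangentSpace (𝓡 n) x →L[ℝ] TangentSpace (𝓡 n) x →L[ℝ] ℝ)) x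
        (B.bilinearComp (translationToOne n x) (translationToOne n x))) := by
  intro x₀
  have : IsManifold (𝓡 n) 1 G := IsManifold.of_le (n := ∞) (by simp)
  have hA := ContMDiffAt.mfderiv (I := 𝓡 n) (I' := 𝓡 n) (n := ∞) (m := ∞) (x₀ := x₀)
    (fun x y : G ↦ x⁻¹ * y) id
    ((contMDiff_fst.inv.mul contMDiff_snd :
      ContMDiff ((𝓡 n).prod (𝓡 n)) (𝓡 n) ∞ fun q : G × G ↦ q.1⁻¹ * q.2).contMDiffAt)
    contMDiffAt_id (by simp)
  rw [contMDiffAt_hom_bundle]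
  refine ⟨contMDiffAt_id, ?_⟩
  have hsmooth : ContDiff ℝ ∞ fun L : EuclideanSpace ℝ (Fin n) →L[ℝ] EuclideanSpace ℝ (Fin n) ↦
      B.bilinearComp L L := contDiff_bilinearComp_self B
  refine (hsmooth.contDiffAt.contMDiffAt.comp x₀ hA).congr_of_eventuallyEq ?_
  have hsrc : (chartAt (EuclideanSpace ℝ (Fin n)) x₀).source ∈ nhds x₀ := chart_source_mem_nhds _ _
  filter_upwards [hsrc] with x hx
  ext v w
  refine (inCoordinates_apply_eq₂ (F₁ := EuclideanSpace ℝ (Fin n))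
    (E₁ := fun x : G ↦ TangentSpace (𝓡 n) x) (F₂ := EuclideanSpace ℝ (Fin n))
    (E₂ := fun x : G ↦ TangentSpace (𝓡 n) x) (F₃ := ℝ) (E₃ := Bundle.Trivial G ℝ)
    (ϕ := B.bilinearComp (translationToOne n x) (translationToOne n x)) (v := v) (w := w)
    hx hx (mem_univ x)).trans ?_
  -- The target points x⁻¹x and x₀⁻¹x₀ both equal 1, but only propositionally; the trivialization
  -- there is the identity.
  have hone : ∀ (y y₀ : G), y = y₀ → ∀ u : EuclideanSpace ℝ (Fin n),
      (trivializationAt (EuclideanSpace ℝ (Fin n)) (TangentSpace (𝓡 n)) y₀).continuousLinearMapAt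
        ℝ y u = u := by
    rintro y _ rfl u
    rw [TangentBundle.continuousLinearMapAt_trivializationAt (mem_chart_source _ y),
      mfderiv_extChartAt_self]
    rfl
  have hcoord : ∀ u : EuclideanSpace ℝ (Fin n),
      inTangentCoordinates (𝓡 n) (𝓡 n) id (fun x : G ↦ x⁻¹ * id x)
        (fun x ↦ mfderiv (𝓡 n) (𝓡 n) (fun y ↦ x⁻¹ * y) (id x)) x₀ x u =
      translationToOne n x
        ((trivializationAt (EuclideanSpace ℝ (Fin n)) (TangentSpace (𝓡 n)) x₀).symm x u) :=
    fun u ↦ (hone (x⁻¹ * x) (x₀⁻¹ * x₀) (by simp) _).trans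
      (congrArg (translationToOne n x) (Trivialization.symmL_apply _ hx u))
  simp only [Function.comp_apply, ContinuousLinearMap.bilinearComp_apply, hcoord]
  simp
  rfl

/-- The left-invariant metric with a given value at the identity. -/
noncomputable def leftInvariantMetric
    (B : EuclideanSpace ℝ (Fin n) →L[ℝ] EuclideanSpace ℝ (Fin n) →L[ℝ] ℝ)
    (hsymm : ∀ v w, B v w = B w v) (hpos : ∀ v, v ≠ 0 → 0 < B v v) : RiemMetric n G where
  inner x := B.bilinearComp (translationToOne n x) (translationToOne n x)
  symm _ _ _ := hsymm _ _
  pos x _ hv := hpos _ fun h0 ↦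
    hv (translationToOne_injective x (h0.trans (map_zero (translationToOne n x)).symm))
  isVonNBounded x := isVonNBounded_of_posDef (E := EuclideanSpace ℝ (Fin n))
    (B.bilinearComp (translationToOne n x) (translationToOne n x)) fun _ hv ↦ hpos _ fun h0 ↦
      hv (translationToOne_injective x (h0.trans (map_zero (translationToOne n x)).symm))
  contMDiff := contMDiff_leftInvariantForm B

theorem isLeftInvariantMetric_leftInvariantMetric
    (B : EuclideanSpace ℝ (Fin n) →L[ℝ] EuclideanSpace ℝ (Fin n) →L[ℝ] ℝ)
    (hsymm : ∀ v w, B v w = B w v) (hpos : ∀ v, v ≠ 0 → 0 < B v v) :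
    IsLeftInvariantMetric (leftInvariantMetric (G := G) B hsymm hpos) := by
  intro σ x v w
  change B (translationToOne n (σ * x) _) (translationToOne n (σ * x) _) =
    B (translationToOne n x v) (translationToOne n x w)
  rw [translationToOne_mul, translationToOne_mul]

end LeftInvariantMetric

/-! ### Lifting left-invariant metrics from a quotient group. -/

section Quotient

variable {n m : ℕ} {G H : Type*} [TopologicalSpace G] [ChartedSpace (EuclideanSpace ℝ (Fin n)) G]
  [Group G] [LieGroup (𝓡 n) ∞ G] [TopologicalSpace H] [ChartedSpace (EuclideanSpace ℝ (Fin m)) H]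
  [Group H] [LieGroup (𝓡 m) ∞ H]

/-- Every left-invariant metric on a quotient group is the quotient of a left-invariant metric. -/
theorem exists_isLeftInvariantMetric_isRiemannianSubmersion {φ : G →* H}
    (hφ : IsSmoothSubmersion n m φ) {h : RiemMetric m H} (hh : IsLeftInvariantMetric h) :
    ∃ g : RiemMetric n G, IsLeftInvariantMetric g ∧ IsRiemannianSubmersion g h φ := by
  let L : EuclideanSpace ℝ (Fin n) →L[ℝ] EuclideanSpace ℝ (Fin m) := mfderiv (𝓡 n) (𝓡 m) φ 1
  have hL : Function.Surjective L := hφ.2 1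
  let b : EuclideanSpace ℝ (Fin m) →L[ℝ] EuclideanSpace ℝ (Fin m) →L[ℝ] ℝ := h.inner (φ 1)
  have hbsymm : ∀ v w, b v w = b w v := h.symm (φ 1)
  have hbpos : ∀ v, v ≠ 0 → 0 < b v v := h.pos (φ 1)
  have hbnn : ∀ v, 0 ≤ b v v := fun v ↦ riemMetric_nonneg h (φ 1) v
  obtain ⟨S, hS⟩ := L.toLinearMap.exists_rightInverse_of_surjective (LinearMap.range_eq_top.2 hL)
  have hLS : ∀ w, L (S w) = w := LinearMap.congr_fun hS
  let P : EuclideanSpace ℝ (Fin n) →L[ℝ] EuclideanSpace ℝ (Fin n) :=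
    ContinuousLinearMap.id ℝ _ - (LinearMap.toContinuousLinearMap S).comp L
  have hP : ∀ v, P v = v - S (L v) := fun v ↦ rfl
  have hLP : ∀ v, L (P v) = 0 := fun v ↦ by rw [hP, map_sub, hLS, sub_self]
  have hPker : ∀ v, L v = 0 → P v = v := fun v hv ↦ by rw [hP, hv, map_zero, sub_zero]
  let e : EuclideanSpace ℝ (Fin n) →L[ℝ] EuclideanSpace ℝ (Fin n) →L[ℝ] ℝ := innerSL ℝ
  -- P projects onto ker L along the range of S. The two summands make ker L and ker P orthogonal,
  -- with L isometric on ker P.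
  let B : EuclideanSpace ℝ (Fin n) →L[ℝ] EuclideanSpace ℝ (Fin n) →L[ℝ] ℝ :=
    b.bilinearComp L L + e.bilinearComp P P
  have hB : ∀ v w, B v w = b (L v) (L w) + inner ℝ (P v) (P w) := fun v w ↦ rfl
  have hsymm : ∀ v w, B v w = B w v := fun v w ↦ by
    rw [hB, hB, hbsymm, real_inner_comm]
  have hpos : ∀ v, v ≠ 0 → 0 < B v v := by
    intro v hv
    rw [hB]
    by_cases hLv : L v = 0
    · rw [hPker v hLv, hLv]
      simpa only [map_zero, zero_add] using real_inner_self_pos.2 hv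
    · exact add_pos_of_pos_of_nonneg (hbpos _ hLv) real_inner_self_nonneg
  have hφm : ∀ x, MDifferentiableAt (𝓡 n) (𝓡 m) φ x := fun x ↦
    (hφ.1 x).mdifferentiableAt (by simp)
  have hcongr : ∀ p q : H, p = q → ∀ v w : EuclideanSpace ℝ (Fin m),
      h.inner p v w = h.inner q v w := by rintro _ _ rfl _ _; rfl
  -- Since φ is a homomorphism, it equals left translation by φ x after φ after left translation by
  -- x⁻¹; everything reduces to the identity.
  have hdφ : ∀ x (v : TangentSpace (𝓡 n) x), mfderiv (𝓡 n) (𝓡 m) φ x v =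
      mfderiv (𝓡 m) (𝓡 m) (fun y ↦ φ x * y) (φ 1) (L (translationToOne n x v)) := by
    intro x v
    have hone : ∀ y, y = (1 : G) → ∀ u : EuclideanSpace ℝ (Fin n),
        (mfderiv (𝓡 m) (𝓡 m) (fun z ↦ φ x * z) (φ y) (mfderiv (𝓡 n) (𝓡 m) φ y u) :
          EuclideanSpace ℝ (Fin m)) =
        mfderiv (𝓡 m) (𝓡 m) (fun z ↦ φ x * z) (φ 1) (L u) := by rintro _ rfl _; rfl
    have h1 := mfderiv_comp_apply (I := 𝓡 n) (I' := 𝓡 n) (I'' := 𝓡 m) x (hφm (x⁻¹ * x))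
      (mdifferentiableAt_leftTranslation (n := n) x⁻¹ x) v
    have h2 := mfderiv_comp_apply (I := 𝓡 n) (I' := 𝓡 m) (I'' := 𝓡 m) x
      (g := fun z ↦ φ x * z) (f := φ ∘ fun y ↦ x⁻¹ * y)
      (mdifferentiableAt_leftTranslation (n := m) (φ x) (φ (x⁻¹ * x)))
      ((hφm (x⁻¹ * x)).comp x (mdifferentiableAt_leftTranslation (n := n) x⁻¹ x)) v
    have h3 : (fun z ↦ φ x * z) ∘ φ ∘ (fun y ↦ x⁻¹ * y) = φ := by
      ext y; simp
    rw [h3] at h2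
    refine h2.trans (Eq.trans ?_ (hone (x⁻¹ * x) (by simp) _))
    exact congrArg (mfderiv (𝓡 m) (𝓡 m) (fun z ↦ φ x * z) (φ (x⁻¹ * x))) h1
  have hinner : ∀ x (v w : TangentSpace (𝓡 n) x),
      h.inner (φ x) (mfderiv (𝓡 n) (𝓡 m) φ x v) (mfderiv (𝓡 n) (𝓡 m) φ x w) =
      b (L (translationToOne n x v)) (L (translationToOne n x w)) := by
    intro x v w
    refine Eq.trans ?_ (hh (φ x) (φ 1) (L (translationToOne n x v)) (L (translationToOne n x w)))
    rw [hdφ, hdφ]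
    exact hcongr _ _ (by simp) _ _
  have hker : ∀ x (u : TangentSpace (𝓡 n) x), L (translationToOne n x u) = 0 →
      mfderiv (𝓡 n) (𝓡 m) φ x u = 0 := by
    intro x u hu
    by_contra hne
    have h1 := h.pos _ _ hne
    rw [hinner, hu, map_zero] at h1
    exact lt_irrefl _ h1
  refine ⟨leftInvariantMetric B hsymm hpos,
    isLeftInvariantMetric_leftInvariantMetric B hsymm hpos, hφ, fun x v w hv _ ↦ ?_⟩
  rw [hinner]
  change _ = B (translationToOne n x v) (translationToOne n x w)
  -- Test horizontality of v against the vertical vector u whose translate to 1 is P v: this gives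
  -- ‖P v‖² = 0.
  have hPv : P (translationToOne n x v) = 0 := by
    obtain ⟨u, hu⟩ := translationToOne_surjective (n := n) x (P (translationToOne n x v))
    have h1 : B (translationToOne n x v) (translationToOne n x u) = 0 :=
      hv u (hker x u (by rw [hu, hLP]))
    rw [hu, hB, hLP, map_zero, zero_add, hPker _ (hLP _)] at h1
    exact inner_self_eq_zero.1 h1
  rw [hB, hPv, inner_zero_left, add_zero]

end Quotient

/-! ### Doubling constants of homogeneous spaces and quotient groups -/

section Doubling

variable {n m : ℕ} {G : Type*} [TopologicalSpace G] [T2Space G] [SecondCountableTopology G]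
  [ChartedSpace (EuclideanSpace ℝ (Fin n)) G] [Group G] [LieGroup (𝓡 n) ∞ G] [MeasurableSpace G]
  [BorelSpace G] {g : RiemMetric n G}

theorem IsLeftInvariantMetric.doublingConst_le_sq_of_action (hg : IsLeftInvariantMetric g)
    (μ : Measure G) [μ.IsHaarMeasure] [μ.IsMulRightInvariant] {M : Type*} [MeasurableSpace M]
    {ν : Measure M} [SigmaFinite ν] {a : M → G → M}
    (ha : Measurable fun q : M × G ↦ a q.1 q.2) (hν : ∀ σ, ν.map (fun x ↦ a x σ) = ν)
    (hmul : ∀ x σ τ, a x (σ * τ) = a (a x σ) τ) (h_one : ∀ x, a x 1 = x)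
    (htrans : ∀ x y, ∃ σ, a x σ = y) {d : M → M → ℝ≥0∞} (hd : ∀ x, Measurable (d x))
    (hle : ∀ x σ, d x (a x σ) ≤ riemDist g 1 σ)
    (hlift : ∀ x y s, d x y < s → ∃ σ, a x σ = y ∧ riemDist g 1 σ < s) :
    doublingConst d ν ≤ doublingConst (riemDist g) μ ^ 2 := by
  have : IsTopologicalGroup G := topologicalGroup_of_lieGroup (𝓡 n) ∞
  have : LocallyCompactSpace G := Manifold.locallyCompact_of_finiteDimensional (𝓡 n)
  refine _root_.doublingConst_le_sq_of_action ha hν hmul h_one htrans hd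
    (continuous_riemDist g 1).measurable hg.riemDist_mul_left (riemDist_comm g)
    (riemDist_triangle g) (fun r hr ↦ ?_) ?_ hle hlift
  · refine (Measure.measure_pos_of_mem_nhds μ (x := 1) ?_).ne'
    filter_upwards [eventually_riemDist_lt g 1 (ENNReal.ofReal_pos.2 hr)] with σ hσ using hσ.le
  -- Small metric balls lie in a compact neighbourhood of 1, so they have finite Haar measure.
  · obtain ⟨K, hK, hK1⟩ := exists_compact_mem_nhds (1 : G)
    obtain ⟨c, hc, hcK⟩ := exists_riemDist_lt_subset g 1 hK1
    obtain ⟨r, hr0, hrc⟩ := ENNReal.lt_iff_exists_nnreal_btwn.1 hc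
    refine ⟨r, by exact_mod_cast hr0, ne_top_of_le_ne_top hK.measure_lt_top.ne
      (measure_mono fun σ hσ ↦ hcK ?_)⟩
    rw [mem_ofPred_eq, ENNReal.ofReal_coe_nnreal] at hσ
    exact lt_of_le_of_lt hσ hrc

theorem IsRiemannianSubmersion.doublingConst_le_sq [ConnectedSpace G]
    (hg : IsLeftInvariantMetric g) (μ : Measure G) [μ.IsHaarMeasure] [μ.IsMulRightInvariant]
    {M : Type*} [TopologicalSpace M] [T2Space M] [SecondCountableTopology M]
    [ChartedSpace (EuclideanSpace ℝ (Fin m)) M] [IsManifold (𝓡 m) ∞ M] [MeasurableSpace M]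
    [BorelSpace M] [MulAction Gᵐᵒᵖ M] [MulAction.IsPretransitive Gᵐᵒᵖ M]
    (hact : Continuous fun q : M × G ↦ q.1 <• q.2) {p : M} (ν : Measure M)
    [IsFiniteMeasureOnCompacts ν] [SMulInvariantMeasure Gᵐᵒᵖ M ν] {h : RiemMetric m M}
    (hp : IsRiemannianSubmersion g h fun σ : G ↦ p <• σ) :
    doublingConst (riemDist h) ν ≤ doublingConst (riemDist g) μ ^ 2 := by
  have : LocallyCompactSpace M := Manifold.locallyCompact_of_finiteDimensional (𝓡 m)
  have hmul : ∀ (x : M) (σ τ : G), x <• (σ * τ) = x <• σ <• τ := fun x σ τ ↦ by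
    rw [MulOpposite.op_mul, mul_smul]
  have h_one : ∀ x : M, x <• (1 : G) = x := fun x ↦ by rw [MulOpposite.op_one, one_smul]
  have htrans : ∀ x y : M, ∃ σ : G, x <• σ = y := fun x y ↦ by
    obtain ⟨σ, hσ⟩ := MulAction.exists_smul_eq Gᵐᵒᵖ x y
    exact ⟨σ.unop, hσ⟩
  -- The element x y⁻¹ stabilizes p, so left translation by it preserves every fibre of the orbit
  -- map.
  have hfib : ∀ x y : G, p <• x = p <• y → ∃ κ, κ * y = x ∧ ∀ z, p <• (κ * z) = p <• z := by
    intro x y hxy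
    refine ⟨x * y⁻¹, by simp, fun z ↦ ?_⟩
    rw [mul_assoc, hmul, hxy, ← hmul, mul_inv_cancel_left]
  refine hg.doublingConst_le_sq_of_action μ (a := fun x σ ↦ x <• σ) hact.measurable
    (fun σ ↦ ?_) hmul h_one htrans (fun x ↦ (continuous_riemDist h x).measurable)
    (fun x σ ↦ ?_) fun x y s hs ↦ ?_
  · have hm : Measurable fun x : M ↦ x <• σ :=
      (hact.comp (continuous_id.prodMk continuous_const)).measurable
    ext s hs
    rw [Measure.map_apply hm hs]
    exact SMulInvariantMeasure.measure_preimage_smul (MulOpposite.op σ) hs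
  · obtain ⟨τ, rfl⟩ := htrans p x
    have h1 := hp.riemDist_le τ (τ * σ)
    have h2 := hg.riemDist_mul_left τ 1 σ
    rw [mul_one] at h2
    rwa [h2, hmul] at h1
  · obtain ⟨τ, rfl⟩ := htrans p x
    obtain ⟨b, hb, hbs⟩ := hp.exists_lift_of_riemDist_lt hg (htrans p) hfib hs
    refine ⟨τ⁻¹ * b, ?_, ?_⟩
    · rw [← hmul, mul_inv_cancel_left]
      exact hb
    · have h2 := hg.riemDist_mul_left τ 1 (τ⁻¹ * b)
      rw [mul_one, mul_inv_cancel_left] at h2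
      rwa [← h2]

theorem IsRiemannianSubmersion.doublingConst_riemVolume_le_sq [ConnectedSpace G]
    (hg : IsLeftInvariantMetric g) (μ : Measure G) [μ.IsHaarMeasure] [μ.IsMulRightInvariant]
    {H : Type*} [TopologicalSpace H] [T2Space H] [SecondCountableTopology H]
    [ChartedSpace (EuclideanSpace ℝ (Fin m)) H] [Group H] [LieGroup (𝓡 m) ∞ H]
    [MeasurableSpace H] [BorelSpace H] {φ : G →* H} (hsurj : Function.Surjective φ)
    {h : RiemMetric m H} (hh : IsLeftInvariantMetric h) (hφ : IsRiemannianSubmersion g h φ) :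
    doublingConst (riemDist h) (riemVolume h) ≤ doublingConst (riemDist g) μ ^ 2 := by
  have : IsTopologicalGroup G := topologicalGroup_of_lieGroup (𝓡 n) ∞
  have : IsTopologicalGroup H := topologicalGroup_of_lieGroup (𝓡 m) ∞
  have : LocallyCompactSpace H := Manifold.locallyCompact_of_finiteDimensional (𝓡 m)
  have := hh.isHaarMeasure_riemVolume
  have hinv : ∀ y, riemDist h 1 y⁻¹ = riemDist h 1 y := fun y ↦ by
    have h' := hh.riemDist_mul_left y 1 y⁻¹
    rw [mul_one, mul_inv_cancel] at h'
    rw [← h', riemDist_comm]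
  -- `H` need not be unimodular a priori, so `G` is made to act by left translations.
  have hright : doublingConst (riemDist h) (riemVolume h) ≤
      doublingConst (fun x y ↦ riemDist h 1 (x * y⁻¹)) (riemVolume h) := by
    refine iSup_le fun x ↦ iSup_le fun r ↦ iSup_le fun hr ↦
      le_iSup_of_le 1 (le_iSup_of_le r (le_iSup_of_le hr (le_of_eq ?_)))
    -- Left invariance moves the ball to 1, where the original distance and the one adapted to the
    -- action have the same balls, because inversion preserves the distance to 1.
    have hball : ∀ s : ℝ≥0∞, riemVolume h {y | riemDist h x y ≤ s} =
        riemVolume h {y | riemDist h 1 (1 * y⁻¹) ≤ s} := by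
      intro s
      rw [← measure_preimage_mul (riemVolume h) x]
      congr 1
      ext y
      have h' := hh.riemDist_mul_left x 1 y
      rw [mul_one] at h'
      simp only [preimage_ofPred_eq, mem_ofPred_eq, one_mul, hinv, h']
    rw [hball, hball]
  refine hright.trans ?_
  have hφc : Continuous φ := hφ.1.1.continuous
  refine hg.doublingConst_le_sq_of_action μ (a := fun x σ ↦ (φ σ)⁻¹ * x) ?_
    (fun σ ↦ map_mul_left_eq_self (riemVolume h) _) (fun x σ τ ↦ by simp [mul_assoc]) (by simp)
    (fun x y ↦ ?_) (fun x ↦ ?_) (fun x σ ↦ ?_) fun x y s hs ↦ ?_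
  · exact ((hφc.comp continuous_snd).inv.mul continuous_fst).measurable
  · obtain ⟨σ, hσ⟩ := hsurj (x * y⁻¹)
    exact ⟨σ, by simp [hσ]⟩
  · exact ((continuous_riemDist h 1).comp (continuous_const.mul continuous_inv)).measurable
  · have h1 := hφ.riemDist_le 1 σ
    simpa using h1
  · have hfib : ∀ x y : G, φ x = φ y → ∃ κ, κ * y = x ∧ ∀ z, φ (κ * z) = φ z := fun x y hxy ↦
      ⟨x * y⁻¹, by simp, fun z ↦ by simp [hxy]⟩
    rw [← map_one φ] at hs
    obtain ⟨σ, hσ, hσs⟩ := hφ.exists_lift_of_riemDist_lt hg hsurj hfib hs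
    exact ⟨σ, by simp [hσ], hσs⟩

end Doubling

theorem mainTheorem5 {n : ℕ} (G : Type*) [TopologicalSpace G] [T2Space G]
    [SecondCountableTopology G] [ConnectedSpace G] [ChartedSpace (EuclideanSpace ℝ (Fin n)) G]
    [Group G] [LieGroup (𝓡 n) ∞ G] [MeasurableSpace G] [BorelSpace G]
    -- `G` is unimodular, with bi-invariant Haar measure `μ`
    (μ : Measure G) [μ.IsHaarMeasure] [μ.IsMulRightInvariant] :
    -- homogeneous spaces: `G` acts smoothly and transitively on `M` from the right,
    -- and `ν` is a `G`-invariant Radon measure on `M`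
    (∀ {m : ℕ} (M : Type*) [TopologicalSpace M] [T2Space M] [SecondCountableTopology M]
      [ChartedSpace (EuclideanSpace ℝ (Fin m)) M] [IsManifold (𝓡 m) ∞ M]
      [MeasurableSpace M] [BorelSpace M]
      [MulAction Gᵐᵒᵖ M] [MulAction.IsPretransitive Gᵐᵒᵖ M],
      ContMDiff ((𝓡 m).prod (𝓡 n)) (𝓡 m) ∞ (fun q : M × G ↦ q.1 <• q.2) →
      ∀ (p : M) (ν : Measure M) [IsFiniteMeasureOnCompacts ν] [SMulInvariantMeasure Gᵐᵒᵖ M ν],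
        (∀ (g : RiemMetric n G) (h : RiemMetric m M), IsLeftInvariantMetric g →
          IsRiemannianSubmersion g h (fun σ : G ↦ p <• σ) →
          doublingConst (riemDist h) ν ≤ doublingConst (riemDist g) μ ^ 2) ∧
        (IsUniformlyDoubling n G →
          ∃ C : ℝ≥0, ∀ (g : RiemMetric n G) (h : RiemMetric m M), IsLeftInvariantMetric g →
            IsRiemannianSubmersion g h (fun σ : G ↦ p <• σ) →
            doublingConst (riemDist h) ν ≤ C)) ∧
    -- quotient groups: `H = G / ker φ` with its quotient Lie group structure
    (∀ {m : ℕ} (H : Type*) [TopologicalSpace H] [T2Space H] [SecondCountableTopology H]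
      [ChartedSpace (EuclideanSpace ℝ (Fin m)) H] [Group H] [LieGroup (𝓡 m) ∞ H]
      [MeasurableSpace H] [BorelSpace H] (φ : G →* H),
      Function.Surjective φ → IsSmoothSubmersion n m φ →
        (∀ (𝓛G : Set (RiemMetric n G)) (𝓛H : Set (RiemMetric m H)),
          (∀ g ∈ 𝓛G, IsLeftInvariantMetric g) → (∀ h ∈ 𝓛H, IsLeftInvariantMetric h) →
          (∀ h ∈ 𝓛H, ∃ g ∈ 𝓛G, IsRiemannianSubmersion g h φ) →
          UniformlyDoublingOn 𝓛G → UniformlyDoublingOn 𝓛H) ∧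
        (IsUniformlyDoubling n G → IsUniformlyDoubling m H)) := by

  refine ⟨fun {m} M _ _ _ _ _ _ _ _ _ hact p ν _ _ ↦ ⟨fun g h hg hp ↦
    hp.doublingConst_le_sq hg μ hact.continuous ν, ?_⟩,
    fun {m} H _ _ _ _ _ _ _ _ φ hsurj hφ ↦ ?_⟩
  · rintro ⟨C, hC⟩
    refine ⟨C ^ 2, fun g h hg hp ↦ ?_⟩
    refine (hp.doublingConst_le_sq hg μ hact.continuous ν).trans ?_
    rw [← hg.doublingConst_riemVolume μ, ENNReal.coe_pow]
    exact pow_le_pow_left' (hC g hg) 2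
  · have hquot : ∀ (𝓛G : Set (RiemMetric n G)) (𝓛H : Set (RiemMetric m H)),
        (∀ g ∈ 𝓛G, IsLeftInvariantMetric g) → (∀ h ∈ 𝓛H, IsLeftInvariantMetric h) →
        (∀ h ∈ 𝓛H, ∃ g ∈ 𝓛G, IsRiemannianSubmersion g h φ) →
        UniformlyDoublingOn 𝓛G → UniformlyDoublingOn 𝓛H := by
      rintro 𝓛G 𝓛H hG hH hsub ⟨C, hC⟩
      refine ⟨C ^ 2, fun h hh ↦ ?_⟩
      obtain ⟨g, hg, hgh⟩ := hsub h hh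
      refine (hgh.doublingConst_riemVolume_le_sq (hG g hg) μ hsurj (hH h hh)).trans ?_
      rw [← (hG g hg).doublingConst_riemVolume μ, ENNReal.coe_pow]
      exact pow_le_pow_left' (hC g hg) 2
    -- The last claim is the previous one for the full sets of left-invariant metrics, since each
    -- metric on H lifts.
    exact ⟨hquot, hquot _ _ (fun _ hg ↦ hg) (fun _ hh ↦ hh) fun h hh ↦
      exists_isLeftInvariantMetric_isRiemannianSubmersion hφ hh⟩
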